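/- Let $W$ be a vector space of dimension $n$ over a finite field $\mathbb{F}_q$, with a flag $\mathcal{F}=(0=F_0\subsetneq F_1\subsetneq\cdots\subsetneq F_\ell=W)$, and put $r_i=\dim F_i$. Let $P_{\mathcal F}\le \mathrm{GL}(W)$ be the stabiliser of the flag, let $\mathcal{M}_{\mathcal F}=\{\varphi\in\mathrm{Hom}(W,W)\mid \varphi(F_i)\subseteq F_i \text{ for all } i\}$, let $G_1,G_2$ be subgroups of $P_{\mathcal F}$, and put $W_1=W_2=W$, $V=W_1\oplus W_2$. The parabolic gluing $G_1\times_{\mathcal F}G_2$ is the group of triples $(g_1,\varphi,g_2)\in G_1\times\mathcal{M}_{\mathcal F}\times G_2$ with product $(g_1,\varphi,g_2)(g_1',\varphi',g_2')=(g_1g_1',\,g_1\varphi'+\varphi g_2',\,g_2g_2')$, acting on $V$ by $(g_1,\varphi,g_2)(w_1\oplus w_2)=(g_1w_1+\varphi(w_2))\oplus g_2w_2$. For a representation $U$ of a group $G$, $\mathbb{F}_q[U]$ denotes the symmetric algebra on $U^*$ and $\mathbb{F}_q[U]^G$ its subalgebra of $G$-invariants; $\mathbb{F}_q[W_1]$ and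 $\mathbb{F}_q[W_2]$ are regarded as subalgebras of $\mathbb{F}_q[V]$. Let $y_1,\dots,y_n$ be a basis of $W_1^*$ consistent with the flag, i.e. for every $i$ the forms $y_{r_i+1},\dots,y_n$ span the image of $(W/F_i)^*$ in $W^*$. A sequence $f_1,\dots,f_n\in\mathbb{F}_q[W_1]$ of homogeneous polynomials is called consistent with $\mathcal F$ if $f_j\in\mathbb{F}_q[y_{r_i+1},\dots,y_n]$ whenever $r_i<j\le r_{i+1}$. In this case let $\widetilde{f_j}\in\mathbb{F}_q[V]$ be obtained from $f_j$ by substituting $N_{i+1}(y_k)$ for each $y_k$, where $N_{i+1}(t)=\prod_{u\in\widetilde U_{i+1}}(t+u)$ and $\widetilde U_{i+1}$ is the image of $(W/F_i)^*$ in $W_2^*$. **Theorem.** Suppose that $\mathbb{F}_q[W_1]^{G_1}=\mathbb{F}_q[f_1,\dots,f_n]$ with $f_1,\dots,f_n$ homogeneous and consistent with $\mathcal F$, and that $\mathbb{F}_q[W_2]^{G_2}=\mathbb{F}_q[h_1,\dots,h_n]$ with $h_1,\dots,h_n$ homogeneous. Then $$\mathbb{F}_q[V]^{G_1\times_{\mathcal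 F}G_2}=\mathbb{F}_q[\widetilde{f_1},\dots,\widetilde{f_n},h_1,\dots,h_n],$$ and $\widetilde{f_1},\dots,\widetilde{f_n},h_1,\dots,h_n$ are algebraically independent, so that this ring of invariants is a polynomial algebra. -/

import Mathlib

open Module

noncomputable section

/-! ### The coordinate ring `K[V]`, the action on it and its invariants -/

section Invariants

variable {K V V' : Type*} [Field K] [AddCommGroup V] [Module K V] [AddCommGroup V'] [Module K V']

/-- `K[V]`: the symmetric algebra on the dual space `V*`. -/
abbrev CoordRing (K V : Type*) [Field K] [AddCommGroup V] [Module K V] : Type _ :=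
  SymmetricAlgebra K (Dual K V)

/-- A linear form on `V`, as an element of `K[V]`. -/
def linForm : Dual K V →ₗ[K] CoordRing K V :=
  SymmetricAlgebra.ι K (Dual K V)

/-- The algebra homomorphism `K[V'] → K[V]` induced by a linear map `T : V → V'`; on linear forms
it is `φ ↦ φ ∘ T`. -/
def coordPullback (T : V →ₗ[K] V') : CoordRing K V' →ₐ[K] CoordRing K V :=
  SymmetricAlgebra.lift (linForm ∘ₗ T.dualMap)

/-- `K[V]^G = {f | f · g = f for all g ∈ G}`, where the right action of `g` on `K[V]` extends
`(φ · g)(v) = φ (g · v)` from `V*`. -/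
def invariantRing {G : Type*} [Group G] (ρ : Representation K G V) :
    Subalgebra K (CoordRing K V) where
  carrier := {f | ∀ g, coordPullback (ρ g) f = f}
  mul_mem' ha hb g := by rw [map_mul, ha g, hb g]
  add_mem' ha hb g := by rw [map_add, ha g, hb g]
  algebraMap_mem' r g := AlgHom.commutes _ r

/-- `f ∈ K[V]` is homogeneous (of some degree `d`): it is a linear combination of products of `d`
linear forms. -/
def IsHomogeneousForm (f : CoordRing K V) : Prop :=
  ∃ d : ℕ, f ∈ (LinearMap.range (linForm (K := K) (V := V))) ^ d

end Invariants

/-! ### Gluing -/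

section Gluing

variable {K G₁ G₂ W₁ W₂ : Type*} [Field K] [Group G₁] [Group G₂]
  [AddCommGroup W₁] [Module K W₁] [AddCommGroup W₂] [Module K W₂]

/-- A left `ℤ G₁` / right `ℤ G₂` sub-bimodule of `Hom_K(W₂, W₁)`. -/
structure GluingBimodule (ρ₁ : Representation K G₁ W₁) (ρ₂ : Representation K G₂ W₂)
    extends AddSubgroup (W₂ →ₗ[K] W₁) where
  left_mem : ∀ (g : G₁) {φ : W₂ →ₗ[K] W₁}, φ ∈ carrier → ρ₁ g ∘ₗ φ ∈ carrier
  right_mem : ∀ (g : G₂) {φ : W₂ →ₗ[K] W₁}, φ ∈ carrier → φ ∘ₗ ρ₂ g ∈ carrier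

variable {ρ₁ : Representation K G₁ W₁} {ρ₂ : Representation K G₂ W₂}

/-- The gluing `G₁ ×_M G₂` of `G₁` to `G₂` through `M`: triples `(g₁, φ, g₂)`. -/
@[ext]
structure Gluing (M : GluingBimodule ρ₁ ρ₂) where
  fst : G₁
  hom : W₂ →ₗ[K] W₁
  snd : G₂
  hom_mem : hom ∈ M.toAddSubgroup

namespace Gluing

variable {M : GluingBimodule ρ₁ ρ₂}

/-- `(g₁, φ, g₂) (g₁', φ', g₂') = (g₁ g₁', g₁ φ' + φ g₂', g₂ g₂')`. -/
instance : Mul (Gluing M) where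
  mul a b :=
    { fst := a.fst * b.fst
      hom := ρ₁ a.fst ∘ₗ b.hom + a.hom ∘ₗ ρ₂ b.snd
      snd := a.snd * b.snd
      hom_mem := M.add_mem (M.left_mem _ b.hom_mem) (M.right_mem _ a.hom_mem) }

instance : One (Gluing M) where
  one := { fst := 1, hom := 0, snd := 1, hom_mem := M.zero_mem }

instance : Inv (Gluing M) where
  inv a :=
    { fst := a.fst⁻¹
      hom := -(ρ₁ a.fst⁻¹ ∘ₗ (a.hom ∘ₗ ρ₂ a.snd⁻¹))
      snd := a.snd⁻¹
      hom_mem := M.neg_mem (M.left_mem _ (M.right_mem _ a.hom_mem)) }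

@[simp] lemma mul_fst (a b : Gluing M) : (a * b).fst = a.fst * b.fst := rfl
@[simp] lemma mul_snd (a b : Gluing M) : (a * b).snd = a.snd * b.snd := rfl
@[simp] lemma mul_hom (a b : Gluing M) :
    (a * b).hom = ρ₁ a.fst ∘ₗ b.hom + a.hom ∘ₗ ρ₂ b.snd := rfl
@[simp] lemma one_fst : (1 : Gluing M).fst = 1 := rfl
@[simp] lemma one_snd : (1 : Gluing M).snd = 1 := rfl
@[simp] lemma one_hom : (1 : Gluing M).hom = 0 := rfl
@[simp] lemma inv_fst (a : Gluing M) : a⁻¹.fst = a.fst⁻¹ := rfl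
@[simp] lemma inv_snd (a : Gluing M) : a⁻¹.snd = a.snd⁻¹ := rfl
@[simp] lemma inv_hom (a : Gluing M) :
    a⁻¹.hom = -(ρ₁ a.fst⁻¹ ∘ₗ (a.hom ∘ₗ ρ₂ a.snd⁻¹)) := rfl

instance : Group (Gluing M) :=
  Group.ofLeftAxioms
    (fun a b c => by
      ext x
      · simp [mul_assoc]
      · simp [add_assoc]
      · simp [mul_assoc])
    (fun a => by ext x <;> simp)
    (fun a => by
      ext x
      · simp
      · simp only [mul_hom, inv_fst, inv_hom, LinearMap.add_apply, LinearMap.comp_apply,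
          LinearMap.neg_apply, one_hom, LinearMap.zero_apply, ← Module.End.mul_apply, ← map_mul]
        simp
      · simp)

/-- The representation of the gluing on `V = W₁ ⊕ W₂`:
`(g₁, φ, g₂) (w₁ ⊕ w₂) = (g₁ w₁ + φ w₂) ⊕ g₂ w₂`. -/
def rep (M : GluingBimodule ρ₁ ρ₂) : Representation K (Gluing M) (W₁ × W₂) where
  toFun a :=
    (ρ₁ a.fst ∘ₗ LinearMap.fst K W₁ W₂ + a.hom ∘ₗ LinearMap.snd K W₁ W₂).prod
      (ρ₂ a.snd ∘ₗ LinearMap.snd K W₁ W₂)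
  map_one' := by ext <;> simp
  map_mul' a b := by ext <;> simp

end Gluing

end Gluing

/-! ### Flags and parabolic gluing

A flag `0 = F₀ < F₁ < ⋯ < F_ℓ = W` is a strictly increasing series `F : LTSeries (Submodule K W)`
of length `ℓ` with `F.head = ⊥` and `F.last = ⊤`. -/

section Parabolic

variable {K W : Type*} [Field K] [AddCommGroup W] [Module K W]

/-- The parabolic subgroup `P_F` of `GL(W)`: the stabiliser of the flag `F`. -/
def parabolicSubgroup (F : LTSeries (Submodule K W)) :
    Subgroup (LinearMap.GeneralLinearGroup K W) where
  carrier := {g | ∀ i, (F i).map (g : W →ₗ[K] W) = F i}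
  mul_mem' {a b} ha hb i := by
    rw [Units.val_mul, Module.End.mul_eq_comp, Submodule.map_comp, hb i, ha i]
  one_mem' i := by
    rw [Units.val_one, Module.End.one_eq_id, Submodule.map_id]
  inv_mem' {a} ha i := by
    conv_lhs => rw [← ha i]
    rw [← Submodule.map_comp, ← Module.End.mul_eq_comp, Units.inv_mul, Module.End.one_eq_id,
      Submodule.map_id]

/-- The natural representation on `W` of a subgroup `G` of `P_F`. -/
def naturalRep {F : LTSeries (Submodule K W)} (G : Subgroup (parabolicSubgroup F)) :
    Representation K G W :=
  (Units.coeHom (W →ₗ[K] W)).comp ((parabolicSubgroup F).subtype.comp G.subtype)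

/-- `M_F = {φ ∈ Hom(W, W) | φ (F_i) ⊆ F_i for all i}`. -/
def flagBimodule {F : LTSeries (Submodule K W)} (G₁ G₂ : Subgroup (parabolicSubgroup F)) :
    GluingBimodule (naturalRep G₁) (naturalRep G₂) where
  carrier := {φ | ∀ i, (F i).map φ ≤ F i}
  add_mem' {φ ψ} hφ hψ i := by
    rw [Submodule.map_le_iff_le_comap] at *
    exact fun w hw => (F i).add_mem (hφ i ⟨w, hw, rfl⟩) (hψ i ⟨w, hw, rfl⟩)
  zero_mem' i := by simp
  neg_mem' {φ} hφ i := by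
    rw [Submodule.map_le_iff_le_comap]
    exact fun w hw => (F i).neg_mem (hφ i ⟨w, hw, rfl⟩)
  left_mem g φ hφ i := by
    rw [Submodule.map_comp]
    exact (Submodule.map_mono (hφ i)).trans (g.1.2 i).le
  right_mem g φ hφ i := by
    rw [Submodule.map_comp]
    exact (Submodule.map_mono (g.1.2 i).le).trans (hφ i)

/-- The parabolic gluing `G₁ ×_F G₂`. -/
abbrev ParabolicGluing {F : LTSeries (Submodule K W)} (G₁ G₂ : Subgroup (parabolicSubgroup F)) :
    Type _ :=
  Gluing (flagBimodule G₁ G₂)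

/-- `r_i = dim F_i = n_1 + ⋯ + n_i`. -/
def flagDim (F : LTSeries (Submodule K W)) (i : Fin (F.length + 1)) : ℕ :=
  finrank K (F i)

/-- A basis `y` of `W*` is consistent with the flag: for every `i` the `y_k` with `k > r_i`
(in `0`-based numbering `r_i ≤ k`) span the image of `(W / F_i)*` in `W*`. -/
def IsFlagBasis (F : LTSeries (Submodule K W)) {n : ℕ} (y : Basis (Fin n) K (Dual K W)) : Prop :=
  ∀ i, Submodule.span K (y '' {k | flagDim F i ≤ (k : ℕ)}) = LinearMap.range (F i).mkQ.dualMap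

/-- A sequence `f_1, …, f_n` of homogeneous elements of `K[W₁]` is consistent with the flag:
`f_j ∈ K[y_{r_i + 1}, …, y_n]` whenever `r_i < j ≤ r_{i+1}`
(in `0`-based numbering `r_i ≤ j < r_{i+1}`). -/
def IsFlagConsistent (F : LTSeries (Submodule K W)) {n : ℕ} (y : Basis (Fin n) K (Dual K W))
    (f : Fin n → CoordRing K W) : Prop :=
  (∀ j, IsHomogeneousForm (f j)) ∧
  ∀ (i : Fin F.length) (j : Fin n), flagDim F i.castSucc ≤ (j : ℕ) → (j : ℕ) < flagDim F i.succ →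
    f j ∈ Algebra.adjoin K ((fun k => linForm (y k)) '' {k | flagDim F i.castSucc ≤ (k : ℕ)})

/-- The index `i` with `r_i < j ≤ r_{i+1}` (in `0`-based numbering `r_i ≤ j < r_{i+1}`): the largest
`i` with `r_i ≤ j`. -/
def flagIndex (F : LTSeries (Submodule K W)) (j : ℕ) : Fin (F.length + 1) :=
  (Finset.univ.filter fun i => flagDim F i ≤ j).sup id

lemma flagIndex_eq [FiniteDimensional K W] (F : LTSeries (Submodule K W)) {j : ℕ}
    (i : Fin F.length) (h₁ : flagDim F i.castSucc ≤ j) (h₂ : j < flagDim F i.succ) :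
    flagIndex F j = i.castSucc := by
  refine le_antisymm (Finset.sup_le fun k hk => ?_)
    (Finset.le_sup (f := id) (Finset.mem_filter.2 ⟨Finset.mem_univ _, h₁⟩))
  by_contra hlt
  have hle : i.succ ≤ k := Fin.castSucc_lt_iff_succ_le.1 (not_le.1 hlt)
  have : flagDim F i.succ ≤ flagDim F k := Submodule.finrank_mono (F.monotone hle)
  have := (Finset.mem_filter.1 hk).2
  omega

/-- For a linear form `y` on `W₁`, the element `∏_{u ∈ U} (y + u)` of `K[W₁ ⊕ W₂]`, where
`W₁ = W₂ = W` and `U` is the image of `(W / F_i)*` in `W₂*`. It is a finite product when `K` is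
finite and `W` is finite-dimensional. -/
def flagNorm (F : LTSeries (Submodule K W)) (i : Fin (F.length + 1)) (y : Dual K W) :
    CoordRing K (W × W) :=
  ∏ᶠ u : LinearMap.range (F i).mkQ.dualMap,
    (linForm (y ∘ₗ LinearMap.fst K W W) + linForm ((u : Dual K W) ∘ₗ LinearMap.snd K W W))

/-- `f̃_j`: with `r_i < j ≤ r_{i+1}`, substitute `∏_{u ∈ (W / F_i)*} (y_k + u)` for each `y_k`
in `f_j`. -/
def flagTilde (F : LTSeries (Submodule K W)) {n : ℕ} (y : Basis (Fin n) K (Dual K W))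
    (f : Fin n → CoordRing K W) (j : Fin n) : CoordRing K (W × W) :=
  SymmetricAlgebra.lift (y.constr K fun k => flagNorm F (flagIndex F j) (y k)) (f j)

/-- The inclusion of `K[W₂]` in `K[W₁ ⊕ W₂]`, where `W₁ = W₂ = W`. -/
def inclSnd : CoordRing K W →ₐ[K] CoordRing K (W × W) :=
  coordPullback (LinearMap.snd K W W)

end Parabolic

end

/-!
The invariants of the gluing are computed through their leading forms in the coordinates `y` of
`W₁`, with coefficients in `R = K[W₂]`. Write `q = |K|`, and let `e_j = dim W / F_i` if
`r_i < j ≤ r_{i+1}`.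

The product `∏ u, (t + u)` over a finite `K`-subspace of a domain is `K`-linear in `t`
(`prodAddLinear`), which makes `f̃_j` invariant (`flagTilde_mem_invariantRing`). Its leading form is
`f_j (y_k ^ (q ^ e_j)) = f_j ^ (q ^ e_j)` (`hasLead_flagTilde`).

Let `P` be the leading form of an arbitrary invariant.
* The elements `(1, φ, 1)` of the gluing, with `φ` of rank one, translate one variable `y_j` by the
  elements of `(W / F_i)*`; hence `y_j` occurs in `P` only with exponents divisible by `q ^ e_j`
  (`card_dvd_of_hasLead`).
* The elements `(g₁, 0, 1)` act by linear substitutions over `K`; hence every `K`-linear functional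
  on the coefficients sends `P` into `K[W₁]^G₁ = K[f_1, …, f_n]`.
* The elements `(1, 0, g₂)` act on the coefficients; hence these are `G₂`-invariant.

A polynomial in the `f_j` in which every `y_k` has exponents divisible by `q ^ e_k` is a polynomial
in the `f_j ^ (q ^ e_j)` (`mem_adjoin_pow_of_mem_adjoin`). Indeed a large `q`-power of it is, and
the polynomials in the `f_j ^ (q ^ e_j)`, in the variables `y_k ^ (q ^ e_k)`, are closed under
extraction of `p`-th roots since their generators have nonzero Jacobian (`mem_adjoin_of_pow_mem`).
This Jacobian is nonzero because that of the `f_j` is, which in turn holds because `K(W)` is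
separable over the fraction field of `K[W]^G₁`
(`det_jacobian_ne_zero_of_invariantRing_eq_adjoin`).

So `P` is a combination of polynomials in the `f_j ^ (q ^ e_j)` with coefficients in
`K[W₂]^G₂ = K[h_1, …, h_n]`, and it is the leading form of a polynomial in the `f̃_j` and `h_j`
(`exists_mem_adjoin_hasLead`). Subtracting the latter and inducting on the degree gives the
generators. There are `dim V` of them, and `K[V]` is algebraic over its ring of invariants, so they
are algebraically independent (`algebraicIndependent_of_invariantRing_eq_adjoin`).
-/

noncomputable section

/-! ### Leading forms -/

section LeadingForm

open MvPolynomial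

variable {σ R : Type*} [CommRing R]

/-- `P` is the leading form of `F` in degree `d`: `P` is homogeneous of degree `d`, and `F` and `P`
have the same coefficients in all degrees `≥ d`. If `F` has degree `< d`, then `P = 0`. -/
def HasLead (d : ℕ) (F P : MvPolynomial σ R) : Prop :=
  P.IsHomogeneous d ∧ ∀ α : σ →₀ ℕ, d ≤ α.degree → coeff α F = coeff α P

namespace HasLead

lemma of_isHomogeneous {d : ℕ} {P : MvPolynomial σ R} (hP : P.IsHomogeneous d) :
    HasLead d P P := ⟨hP, fun _ _ => rfl⟩

lemma homogeneousComponent {d : ℕ} {F : MvPolynomial σ R} (hF : F.totalDegree ≤ d) :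
    HasLead d F (homogeneousComponent d F) := by
  refine ⟨homogeneousComponent_isHomogeneous d F, fun α hα => ?_⟩
  rw [coeff_homogeneousComponent]
  split_ifs with h
  · rfl
  · exact coeff_eq_zero_of_totalDegree_lt (by
      have : d < α.degree := lt_of_le_of_ne hα (Ne.symm h)
      exact lt_of_le_of_lt hF this)

lemma eq {d : ℕ} {F P P' : MvPolynomial σ R} (h : HasLead d F P) (h' : HasLead d F P') :
    P = P' := by
  ext α
  by_cases hα : d ≤ α.degree
  · rw [← h.2 α hα, h'.2 α hα]
  · rw [h.1.coeff_eq_zero (by omega), h'.1.coeff_eq_zero (by omega)]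

lemma add {d : ℕ} {F P F' P' : MvPolynomial σ R} (h : HasLead d F P) (h' : HasLead d F' P') :
    HasLead d (F + F') (P + P') :=
  ⟨h.1.add h'.1, fun α hα => by rw [coeff_add, coeff_add, h.2 α hα, h'.2 α hα]⟩

lemma sub {d : ℕ} {F P F' P' : MvPolynomial σ R} (h : HasLead d F P) (h' : HasLead d F' P') :
    HasLead d (F - F') (P - P') :=
  ⟨h.1.sub h'.1, fun α hα => by rw [coeff_sub, coeff_sub, h.2 α hα, h'.2 α hα]⟩

lemma zero (d : ℕ) : HasLead d (0 : MvPolynomial σ R) 0 :=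
  of_isHomogeneous (isHomogeneous_zero _ _ _)

lemma sum {ι : Type*} (s : Finset ι) {d : ℕ} {F P : ι → MvPolynomial σ R}
    (h : ∀ i ∈ s, HasLead d (F i) (P i)) : HasLead d (∑ i ∈ s, F i) (∑ i ∈ s, P i) := by
  classical
  induction s using Finset.induction_on with
  | empty => simpa using zero d
  | insert a s ha ih =>
    rw [Finset.sum_insert ha, Finset.sum_insert ha]
    exact (h a (Finset.mem_insert_self _ _)).add
      (ih fun i hi => h i (Finset.mem_insert_of_mem hi))

lemma mul {d d' : ℕ} {F P F' P' : MvPolynomial σ R} (h : HasLead d F P)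
    (h' : HasLead d' F' P') : HasLead (d + d') (F * F') (P * P') := by
  classical
  refine ⟨h.1.mul h'.1, fun α hα => ?_⟩
  rw [coeff_mul, coeff_mul]
  refine Finset.sum_congr rfl fun x hx => ?_
  rw [Finset.HasAntidiagonal.mem_antidiagonal] at hx
  have hdeg : x.1.degree + x.2.degree = α.degree := by rw [← hx, map_add]
  by_cases h₁ : d ≤ x.1.degree
  · by_cases h₂ : d' ≤ x.2.degree
    · rw [h.2 _ h₁, h'.2 _ h₂]
    · rw [h.2 _ h₁, h.1.coeff_eq_zero (d := x.1) (by omega), zero_mul, zero_mul]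
  · rw [h'.2 _ (by omega), h'.1.coeff_eq_zero (d := x.2) (by omega), mul_zero, mul_zero]

lemma prod {ι : Type*} (s : Finset ι) {d : ι → ℕ} {F P : ι → MvPolynomial σ R}
    (h : ∀ i ∈ s, HasLead (d i) (F i) (P i)) :
    HasLead (∑ i ∈ s, d i) (∏ i ∈ s, F i) (∏ i ∈ s, P i) := by
  classical
  induction s using Finset.induction_on with
  | empty => simpa using of_isHomogeneous (isHomogeneous_one σ R)
  | insert a s ha ih =>
    rw [Finset.sum_insert ha, Finset.prod_insert ha, Finset.prod_insert ha]
    exact (h a (Finset.mem_insert_self _ _)).mul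
      (ih fun i hi => h i (Finset.mem_insert_of_mem hi))

lemma C (r : R) : HasLead 0 (C r : MvPolynomial σ R) (MvPolynomial.C r) :=
  of_isHomogeneous (isHomogeneous_C _ _)

lemma C_mul {d : ℕ} {F P : MvPolynomial σ R} (r : R) (h : HasLead d F P) :
    HasLead d (MvPolynomial.C r * F) (MvPolynomial.C r * P) := by
  simpa using (C r).mul h

lemma pow {d : ℕ} {F P : MvPolynomial σ R} (h : HasLead d F P) (m : ℕ) :
    HasLead (m * d) (F ^ m) (P ^ m) := by
  simpa using prod (Finset.range m) (fun _ _ => h)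

lemma of_totalDegree_lt {d : ℕ} {F : MvPolynomial σ R} (hF : F.totalDegree < d) :
    HasLead d F 0 :=
  ⟨isHomogeneous_zero _ _ _, fun α hα => by
    rw [coeff_zero]
    exact coeff_eq_zero_of_totalDegree_lt (hF.trans_le hα)⟩

lemma X_add_C (j : σ) (r : R) : HasLead 1 (X j + MvPolynomial.C r) (X j) := by
  rw [← add_zero (X j : MvPolynomial σ R), add_assoc, zero_add]
  exact (of_isHomogeneous (isHomogeneous_X R j)).add (of_totalDegree_lt (by simp))

lemma totalDegree_le {d : ℕ} {F P : MvPolynomial σ R} (h : HasLead d F P) :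
    F.totalDegree ≤ d := by
  refine Finset.sup_le fun α hα => ?_
  by_contra hlt
  have hd : d < α.degree := not_le.1 hlt
  exact (MvPolynomial.mem_support_iff.1 hα) (by rw [h.2 α hd.le, h.1.coeff_eq_zero (by omega)])

lemma homogeneousComponent_of_zero {d : ℕ} {F : MvPolynomial σ R} (h : HasLead (d + 1) F 0) :
    HasLead d F (MvPolynomial.homogeneousComponent d F) := by
  refine ⟨homogeneousComponent_isHomogeneous d F, fun α hα => ?_⟩
  rw [coeff_homogeneousComponent]
  split_ifs with hd
  · rfl
  · rw [h.2 α (by omega), coeff_zero]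

end HasLead

/-- Substituting polynomials with leading forms `P k`, all of the same degree `e`, into a
homogeneous polynomial of degree `d`. -/
lemma MvPolynomial.IsHomogeneous.hasLead_aeval {K τ : Type*} [CommRing K] [Algebra K R] {d e : ℕ}
    {p : MvPolynomial τ K} (hp : p.IsHomogeneous d) {F P : τ → MvPolynomial σ R}
    (h : ∀ k, HasLead e (F k) (P k)) :
    HasLead (d * e) (MvPolynomial.aeval F p) (MvPolynomial.aeval P p) := by
  rw [MvPolynomial.aeval_def, MvPolynomial.aeval_def, eval₂_eq, eval₂_eq]
  refine HasLead.sum _ fun α hα => ?_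
  have hd : ∑ i ∈ α.support, α i * e = d * e := by
    rw [← Finset.sum_mul, ← hp.degree_eq_sum_deg_support hα]
  rw [← hd, IsScalarTower.algebraMap_apply K R, MvPolynomial.algebraMap_eq]
  exact (HasLead.prod _ fun i _ => (h i).pow _).C_mul _

end LeadingForm

/-! ### Polynomials invariant under translations of one variable -/

section Translation

open MvPolynomial

variable {σ R : Type*} [DecidableEq σ] [CommRing R]

/-- The substitution `X j ↦ f`, fixing the other variables. -/
def substVar (j : σ) (f : MvPolynomial σ R) : MvPolynomial σ R →ₐ[R] MvPolynomial σ R :=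
  aeval (Function.update X j f)

lemma substVar_X_self (j : σ) (f : MvPolynomial σ R) : substVar j f (X j) = f := by
  simp [substVar]

lemma substVar_X_of_ne {j k : σ} (f : MvPolynomial σ R) (h : k ≠ j) :
    substVar j f (X k) = X k := by
  simp [substVar, Function.update_of_ne h]

lemma X_sub_dvd_sub_substVar (j : σ) (f F : MvPolynomial σ R) :
    X j - f ∣ F - substVar j f F := by
  rw [← Ideal.mem_span_singleton, ← Ideal.Quotient.eq]
  suffices h : Ideal.Quotient.mkₐ R (Ideal.span {X j - f}) =
      (Ideal.Quotient.mkₐ R (Ideal.span {X j - f})).comp (substVar j f) from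
    DFunLike.congr_fun h F
  refine MvPolynomial.algHom_ext fun k => ?_
  rw [AlgHom.comp_apply]
  by_cases hk : k = j
  · subst hk
    rw [substVar_X_self]
    exact Ideal.Quotient.eq.2 (Ideal.mem_span_singleton_self _)
  · rw [substVar_X_of_ne _ hk]

lemma coeff_substVar_zero (j : σ) (F : MvPolynomial σ R) (α : σ →₀ ℕ) :
    coeff α (substVar j 0 F) = if α j = 0 then coeff α F else 0 := by
  induction F using MvPolynomial.induction_on' with
  | monomial β r =>
    have key : substVar j 0 (monomial β r) = if β j = 0 then monomial β r else 0 := by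
      rw [substVar, aeval_monomial]
      split_ifs with h
      · rw [monomial_eq, MvPolynomial.algebraMap_eq]
        congr 1
        refine Finset.prod_congr rfl fun i hi => ?_
        have hij : i ≠ j := by
          rintro rfl
          exact (Finsupp.mem_support_iff.1 hi) h
        simp only [Function.update_of_ne hij]
      · rw [Finsupp.prod, Finset.prod_eq_zero (Finsupp.mem_support_iff.2 h), mul_zero]
        simp [h]
    rw [key]
    by_cases hαβ : β = α
    · subst hαβ
      split_ifs <;> simp
    · split_ifs <;> simp [coeff_monomial, hαβ]
  | add p q hp hq =>
    rw [map_add, coeff_add, hp, hq, coeff_add]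
    split_ifs <;> simp

variable [IsDomain R]

lemma prod_X_add_C_dvd (j : σ) (s : Finset R) (H : MvPolynomial σ R)
    (h : ∀ u ∈ s, substVar j (C (-u)) H = 0) : ∏ u ∈ s, (X j + C u) ∣ H := by
  classical
  induction s using Finset.induction_on generalizing H with
  | empty => simp
  | insert a s ha ih =>
    have h₁ := X_sub_dvd_sub_substVar j (C (-a)) H
    rw [h a (Finset.mem_insert_self _ _), sub_zero, C_neg, sub_neg_eq_add] at h₁
    obtain ⟨H', rfl⟩ := h₁
    rw [Finset.prod_insert ha]
    refine mul_dvd_mul_left _ (ih H' fun u hu => ?_)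
    have h₂ := h u (Finset.mem_insert_of_mem hu)
    rw [map_mul, map_add, substVar_X_self, ← MvPolynomial.algebraMap_eq, AlgHom.commutes,
      MvPolynomial.algebraMap_eq, ← C_add, mul_eq_zero] at h₂
    refine h₂.resolve_left fun h₃ => ha ?_
    rw [C_eq_zero, neg_add_eq_zero] at h₃
    rwa [← h₃]

/-- If `F` has degree at most `d` and is invariant under the translations `X j ↦ X j + u`, `u ∈ U`,
then `X j` occurs in the degree `d` part of `F` only with exponents divisible by `|U|`. Such an `F`
is a polynomial in `N = ∏ u, (X j + u)`: the difference `F - F(X j = 0)` vanishes at all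
`X j = -u`, so it is `N` times an invariant polynomial of smaller degree. -/
lemma card_dvd_of_translation_invariant {U : Type*} [AddCommGroup U] [Fintype U] (ι : U →+ R)
    (hι : Function.Injective ι) (j : σ) (d : ℕ) (F : MvPolynomial σ R) (hd : F.totalDegree ≤ d)
    (hF : ∀ u, substVar j (X j + C (ι u)) F = F) (α : σ →₀ ℕ) (hα : α.degree = d)
    (hc : coeff α F ≠ 0) : Fintype.card U ∣ α j := by
  classical
  induction d using Nat.strong_induction_on generalizing F α with
  | _ d ih =>
  set N : MvPolynomial σ R := ∏ u, (X j + C (ι u)) with hN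
  have hcomp : ∀ f : MvPolynomial σ R,
      (substVar j f).comp (substVar j 0) = substVar j 0 := fun f => by
    refine MvPolynomial.algHom_ext fun k => ?_
    rw [AlgHom.comp_apply]
    by_cases hk : k = j
    · subst hk; rw [substVar_X_self, map_zero]
    · rw [substVar_X_of_ne _ hk, substVar_X_of_ne _ hk]
  have hcomp' : ∀ u, (substVar j 0).comp (substVar j (X j + C (ι u))) =
      substVar j (C (ι u)) := fun u => by
    refine MvPolynomial.algHom_ext fun k => ?_
    rw [AlgHom.comp_apply]
    by_cases hk : k = j
    · subst hk
      rw [substVar_X_self, map_add, substVar_X_self, zero_add, ← MvPolynomial.algebraMap_eq,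
        AlgHom.commutes, MvPolynomial.algebraMap_eq, substVar_X_self]
    · rw [substVar_X_of_ne _ hk, substVar_X_of_ne _ hk, substVar_X_of_ne _ hk]
  have hNprod : N = ∏ u ∈ Finset.univ.image ι, (X j + C u) := by
    rw [Finset.prod_image fun a _ b _ h => hι h]
  obtain ⟨G, hG⟩ : N ∣ F - substVar j 0 F := by
    rw [hNprod]
    refine prod_X_add_C_dvd j _ _ fun u hu => ?_
    obtain ⟨v, -, rfl⟩ := Finset.mem_image.1 hu
    rw [map_sub, ← AlgHom.comp_apply, hcomp, ← map_neg, ← hcomp' (-v), AlgHom.comp_apply, hF,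
      sub_self]
  have hNlead : HasLead (Fintype.card U) N (X j ^ Fintype.card U) := by
    simpa [hN] using HasLead.prod Finset.univ fun u _ => HasLead.X_add_C j (ι u)
  have hN0 : N ≠ 0 := by
    intro h0
    rw [h0] at hNlead
    exact pow_ne_zero _ (X_ne_zero j) (hNlead.eq (HasLead.zero _))
  have hGinv : ∀ u, substVar j (X j + C (ι u)) G = G := fun u => by
    have hNinv : substVar j (X j + C (ι u)) N = N := by
      rw [hN, map_prod]
      refine Fintype.prod_equiv (Equiv.addLeft u) _ _ fun v => ?_
      rw [map_add, substVar_X_self, ← MvPolynomial.algebraMap_eq, AlgHom.commutes,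
        Equiv.coe_addLeft, map_add, map_add, add_assoc]
    have := congrArg (substVar j (X j + C (ι u))) hG
    rw [map_sub, hF, map_mul, hNinv, ← AlgHom.comp_apply, hcomp, hG] at this
    exact (mul_left_cancel₀ hN0 this).symm
  by_cases hαj : α j = 0
  · rw [hαj]; exact dvd_zero _
  have hcG : coeff α (N * G) ≠ 0 := by
    rw [← hG, coeff_sub, coeff_substVar_zero, if_neg hαj, sub_zero]
    exact hc
  have hG0 : G ≠ 0 := by rintro rfl; simp at hcG
  have hle : (N * G).totalDegree ≤ d := by
    rw [← hG]
    refine (totalDegree_sub _ _).trans (max_le hd (Finset.sup_le fun β hβ => ?_))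
    rw [MvPolynomial.mem_support_iff, coeff_substVar_zero] at hβ
    have hβ' : β ∈ F.support := MvPolynomial.mem_support_iff.2 (by split_ifs at hβ <;> simp_all)
    exact (le_totalDegree hβ').trans hd
  have hNdeg : N.totalDegree = Fintype.card U := by
    refine le_antisymm hNlead.totalDegree_le ?_
    have hs : Finsupp.single j (Fintype.card U) ∈ N.support := by
      rw [MvPolynomial.mem_support_iff, hNlead.2 _ (by simp), X_pow_eq_monomial]
      simp
    simpa using le_totalDegree hs
  rw [totalDegree_mul_of_isDomain hN0 hG0, hNdeg] at hle
  have hGlead : HasLead (d - Fintype.card U) G (homogeneousComponent (d - Fintype.card U) G) :=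
    HasLead.homogeneousComponent (by omega)
  have hNG := hNlead.mul hGlead
  rw [Nat.add_sub_cancel' (by omega)] at hNG
  rw [hNG.2 α hα.ge, X_pow_eq_monomial, coeff_monomial_mul'] at hcG
  split_ifs at hcG with hle'
  · rw [one_mul, coeff_homogeneousComponent] at hcG
    split_ifs at hcG with hdeg
    · have hpos : 0 < Fintype.card U := Fintype.card_pos
      have := ih (d - Fintype.card U) (by omega) G (by omega) hGinv _ hdeg hcG
      rw [Finsupp.tsub_apply, Finsupp.single_eq_same] at this
      have hj : Fintype.card U ≤ α j := by
        simpa using hle'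
      exact (Nat.dvd_sub_iff_left hj (dvd_refl _)).1 this
    · exact absurd rfl hcG
  · exact absurd rfl hcG

end Translation

/-! ### Powers of the variables -/

section Powers

open MvPolynomial

variable {σ K : Type*} [Field K]

lemma algebraicIndependent_X_pow {m : σ → ℕ} (hm : ∀ k, m k ≠ 0) :
    AlgebraicIndependent K fun k => (X k : MvPolynomial σ K) ^ m k := by
  simpa using (algebraicIndependent_X σ K).polynomial_aeval_of_transcendental
    (f := fun k => Polynomial.X ^ m k) fun k => (Polynomial.transcendental_X K).pow
      (Nat.pos_of_ne_zero (hm k))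

/-- Substituting `X k ^ (q ^ e)` for `X k`, where `q = |K|`, is an iterate of the Frobenius map. -/
lemma aeval_X_pow_card [Fintype K] (e : ℕ) (p : MvPolynomial σ K) :
    aeval (fun k => (X k : MvPolynomial σ K) ^ Fintype.card K ^ e) p =
      p ^ Fintype.card K ^ e := by
  induction e generalizing p with
  | zero => simp
  | succ e ih =>
    have h : aeval (fun k => (X k : MvPolynomial σ K) ^ Fintype.card K ^ (e + 1)) =
        (FiniteField.frobeniusAlgHom K (MvPolynomial σ K)).comp
          (aeval fun k => (X k : MvPolynomial σ K) ^ Fintype.card K ^ e) :=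
      MvPolynomial.algHom_ext fun k => by
        simp [FiniteField.coe_frobeniusAlgHom, pow_succ, pow_mul]
    rw [h, AlgHom.comp_apply, ih, FiniteField.coe_frobeniusAlgHom, pow_succ, pow_mul]

lemma pderiv_eq_zero_of_mem_adjoin {s : Set σ} {k : σ} (hk : k ∉ s) {p : MvPolynomial σ K}
    (hp : p ∈ Algebra.adjoin K (X '' s)) : pderiv k p = 0 := by
  refine pderiv_eq_zero_of_notMem_vars fun h => hk ?_
  exact (mem_supported.1 hp) h

end Powers

/-! ### Jacobians in positive characteristic -/

section Jacobian

open MvPolynomial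

variable {σ τ K : Type*} [Field K]

/-- The Jacobian matrix `(∂ t_j / ∂ X_k)`. -/
def jacobian (t : τ → MvPolynomial σ K) : Matrix τ σ (MvPolynomial σ K) :=
  Matrix.of fun j k => pderiv k (t j)

lemma jacobian_apply (t : τ → MvPolynomial σ K) (j : τ) (k : σ) :
    jacobian t j k = pderiv k (t j) := rfl

variable [Fintype σ]

/-- The chain rule. -/
lemma derivation_aeval {A : Type*} [CommRing A] [Algebra K A] (D : Derivation K A A)
    (t : σ → A) (Q : MvPolynomial σ K) :
    D (aeval t Q) = ∑ j, aeval t (pderiv j Q) * D (t j) := by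
  classical
  induction Q using MvPolynomial.induction_on with
  | C a => simp [← MvPolynomial.algebraMap_eq]
  | add p q hp hq => simp only [map_add, hp, hq, add_mul, Finset.sum_add_distrib]
  | mul_X p i hp =>
    simp only [map_mul, aeval_X, Derivation.leibniz, smul_eq_mul, hp, pderiv_X, map_add, add_mul,
      Finset.sum_add_distrib, Finset.mul_sum]
    congr 1
    · rw [Finset.sum_eq_single i]
      · simp
      · intro j _ hj; simp [hj.symm]
      · simp
    · exact Finset.sum_congr rfl fun j _ => by ring

/-- Over a perfect field of characteristic `p`, a polynomial all of whose derivatives vanish is a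
`p`-th power. -/
lemma exists_pow_of_pderiv_eq_zero (p : ℕ) [Fact p.Prime] [CharP K p] [PerfectRing K p]
    (Q : MvPolynomial σ K) (hQ : ∀ j, pderiv j Q = 0) : ∃ Q', Q = Q' ^ p := by
  classical
  have : ExpChar (MvPolynomial σ K) p := .prime Fact.out
  have hdvd : ∀ α ∈ Q.support, ∀ j, p ∣ α j := fun α hα j => by
    by_cases h0 : α j = 0
    · rw [h0]; exact dvd_zero p
    have h := congrArg (coeff (α - Finsupp.single j 1)) (hQ j)
    have hle : Finsupp.single j 1 ≤ α := by
      simpa [Nat.one_le_iff_ne_zero] using h0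
    rw [coeff_pderiv, tsub_add_cancel_of_le hle, coeff_zero, mul_eq_zero] at h
    have h₁ := h.resolve_left (MvPolynomial.mem_support_iff.1 hα)
    rw [Finsupp.tsub_apply, Finsupp.single_eq_same, ← Nat.cast_add_one,
      Nat.sub_add_cancel (Nat.one_le_iff_ne_zero.2 h0)] at h₁
    exact (CharP.cast_eq_zero_iff K p _).1 h₁
  have hmon : ∀ α ∈ Q.support, ∃ P : MvPolynomial σ K, monomial α (coeff α Q) = P ^ p := by
    intro α hα
    choose m hm using hdvd α hα
    obtain ⟨c, hc⟩ := surjective_frobenius K p (coeff α Q)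
    refine ⟨monomial (Finsupp.equivFunOnFinite.symm m) c, ?_⟩
    rw [monomial_pow, ← hc, frobenius_def]
    have hα' : α = p • Finsupp.equivFunOnFinite.symm m := Finsupp.ext fun j => by simp [hm j]
    rw [← hα']
  choose! P hP using hmon
  refine ⟨∑ α ∈ Q.support, P α, ?_⟩
  rw [sum_pow_char, ← Finset.sum_congr rfl hP]
  exact Q.as_sum

variable [DecidableEq σ]

/-- A polynomial subalgebra whose generators have nonzero Jacobian contains every `x` whose `p`-th
power it contains: if `x ^ p = Q(t)`, then by the chain rule `Q` has vanishing derivatives, so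
`Q = Q' ^ p` and `x = Q'(t)`. -/
lemma mem_adjoin_of_pow_mem (p : ℕ) [Fact p.Prime] [CharP K p] [PerfectRing K p]
    {t : σ → MvPolynomial σ K} (ht : AlgebraicIndependent K t) (hJ : (jacobian t).det ≠ 0)
    {x : MvPolynomial σ K} (hx : x ^ p ∈ Algebra.adjoin K (Set.range t)) :
    x ∈ Algebra.adjoin K (Set.range t) := by
  have : ExpChar (MvPolynomial σ K) p := .prime Fact.out
  rw [Algebra.adjoin_range_eq_range_aeval] at hx ⊢
  obtain ⟨Q, hQ⟩ := hx
  change aeval t Q = x ^ p at hQ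
  have hv : Matrix.vecMul (fun j => aeval t (pderiv j Q)) (jacobian t) = 0 := by
    funext k
    have h := derivation_aeval (pderiv k) t Q
    rw [hQ, Derivation.leibniz_pow, ← Nat.cast_smul_eq_nsmul K, CharP.cast_eq_zero K p,
      zero_smul] at h
    exact h.symm
  have hz : ∀ j, pderiv j Q = 0 := fun j => by
    have h := congrFun (Matrix.eq_zero_of_vecMul_eq_zero hJ hv) j
    exact (injective_iff_map_eq_zero _).1 ht _ h
  obtain ⟨Q', rfl⟩ := exists_pow_of_pderiv_eq_zero p Q hz
  rw [map_pow] at hQ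
  exact ⟨Q', frobenius_inj (MvPolynomial σ K) p hQ⟩

lemma mem_adjoin_of_pow_pow_mem (p : ℕ) [Fact p.Prime] [CharP K p] [PerfectRing K p]
    {t : σ → MvPolynomial σ K} (ht : AlgebraicIndependent K t) (hJ : (jacobian t).det ≠ 0)
    (m : ℕ) {x : MvPolynomial σ K} (hx : x ^ p ^ m ∈ Algebra.adjoin K (Set.range t)) :
    x ∈ Algebra.adjoin K (Set.range t) := by
  induction m with
  | zero => simpa using hx
  | succ m ih => exact ih (mem_adjoin_of_pow_mem p ht hJ (by rwa [← pow_mul, ← pow_succ]))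

/-! #### Powers of the generators -/

variable [Fintype K] {f : σ → MvPolynomial σ K} {e : σ → ℕ}

/-- `f_j ^ (q ^ e_j)` with `q = |K|`, written as a polynomial in the `X_k ^ (q ^ e_k)`. -/
def powRoot (f : σ → MvPolynomial σ K) (e : σ → ℕ) (j : σ) : MvPolynomial σ K :=
  aeval (fun k => (X k : MvPolynomial σ K) ^ Fintype.card K ^ (e j - e k)) (f j)

omit [Fintype σ] [DecidableEq σ] in
lemma aeval_powRoot (hf : ∀ j, f j ∈ Algebra.adjoin K (X '' {k | e k ≤ e j})) (j : σ) :
    aeval (fun k => (X k : MvPolynomial σ K) ^ Fintype.card K ^ e k) (powRoot f e j) =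
      f j ^ Fintype.card K ^ e j := by
  rw [← aeval_X_pow_card, powRoot, ← AlgHom.comp_apply]
  refine (AlgHom.adjoin_le_equalizer _ _ ?_) (hf j)
  rintro _ ⟨k, hk, rfl⟩
  rw [AlgHom.comp_apply, aeval_X, map_pow, aeval_X, aeval_X, ← pow_mul, ← pow_add,
    Nat.add_sub_cancel' hk]

/-- Off the diagonal blocks, either `f j` does not involve `X k`, or `X k` occurs in `powRoot f e j`
only through a `p`-th power. -/
lemma jacobian_powRoot (hf : ∀ j, f j ∈ Algebra.adjoin K (X '' {k | e k ≤ e j})) (j k : σ) :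
    jacobian (powRoot f e) j k =
      if e j = e k then
        aeval (fun k => (X k : MvPolynomial σ K) ^ Fintype.card K ^ (e j - e k)) (jacobian f j k)
      else 0 := by
  have hcard : (Fintype.card K : MvPolynomial σ K) = 0 := by
    rw [← map_natCast (C : K →+* MvPolynomial σ K), FiniteField.cast_card_eq_zero, map_zero]
  rw [jacobian_apply, powRoot, derivation_aeval, Finset.sum_eq_single k]
  · rw [pderiv_pow, pderiv_X_self, mul_one, ← jacobian_apply]
    split_ifs with h
    · simp [h]
    · rcases Nat.lt_or_gt_of_ne h with h | h
      · rw [jacobian_apply, pderiv_eq_zero_of_mem_adjoin (s := {k | e k ≤ e j}) (by simpa using h)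
          (hf j), map_zero, zero_mul]
      · rw [Nat.cast_pow, hcard, zero_pow (by omega), zero_mul, mul_zero]
  · intro l _ hl
    rw [pderiv_pow, pderiv_X_of_ne hl, mul_zero, mul_zero]
  · simp

/-- The Jacobian matrix of the polynomials `powRoot f e j` is block diagonal; its diagonal blocks
come from those of the block triangular Jacobian matrix of `f` by injective substitutions. -/
lemma det_jacobian_powRoot_ne_zero
    (hf : ∀ j, f j ∈ Algebra.adjoin K (X '' {k | e k ≤ e j})) (hJ : (jacobian f).det ≠ 0) :
    (jacobian (powRoot f e)).det ≠ 0 := by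
  have hb : (jacobian f).BlockTriangular (OrderDual.toDual ∘ e) := fun j k hjk =>
    pderiv_eq_zero_of_mem_adjoin (s := {k | e k ≤ e j})
      (by simpa using OrderDual.toDual_lt_toDual.1 hjk) (hf j)
  have hb' : (jacobian (powRoot f e)).BlockTriangular (OrderDual.toDual ∘ e) := fun j k hjk => by
    rw [jacobian_powRoot hf, if_neg (OrderDual.toDual_lt_toDual.1 hjk).ne]
  rw [hb.det, Finset.prod_ne_zero_iff] at hJ
  rw [hb'.det, Finset.prod_ne_zero_iff]
  intro a ha
  have hθ : Function.Injective (aeval (R := K) fun k =>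
      (X k : MvPolynomial σ K) ^ Fintype.card K ^ (OrderDual.ofDual a - e k)) :=
    algebraicIndependent_X_pow fun k => pow_ne_zero _ Fintype.card_ne_zero
  have hblock : (jacobian (powRoot f e)).toSquareBlock (OrderDual.toDual ∘ e) a =
      ((jacobian f).toSquareBlock (OrderDual.toDual ∘ e) a).map (aeval (R := K) fun k =>
        (X k : MvPolynomial σ K) ^ Fintype.card K ^ (OrderDual.ofDual a - e k)) := by
    ext1 j k
    have hj : e j = OrderDual.ofDual a := congrArg OrderDual.ofDual j.2
    have hk : e k = OrderDual.ofDual a := congrArg OrderDual.ofDual k.2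
    change jacobian (powRoot f e) j k = aeval _ (jacobian f j k)
    rw [jacobian_powRoot hf, if_pos (hj.trans hk.symm), hj]
  rw [hblock, ← AlgHom.mapMatrix_apply, ← AlgHom.map_det]
  exact fun h => hJ a ha ((injective_iff_map_eq_zero _).1 hθ _ h)

/-- Among the polynomials in `f_1, …, f_n`, those in which each `X_k` occurs with exponents
divisible by `q ^ e_k`, where `q = |K|`, are the polynomials in the `f_j ^ (q ^ e_j)`. -/
lemma mem_adjoin_pow_of_mem_adjoin
    (hf : ∀ j, f j ∈ Algebra.adjoin K (X '' {k | e k ≤ e j})) (hJ : (jacobian f).det ≠ 0)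
    (hfind : AlgebraicIndependent K f) {x : MvPolynomial σ K}
    (hx : aeval (fun k => (X k : MvPolynomial σ K) ^ Fintype.card K ^ e k) x ∈
      Algebra.adjoin K (Set.range f)) :
    aeval (fun k => (X k : MvPolynomial σ K) ^ Fintype.card K ^ e k) x ∈
      Algebra.adjoin K (Set.range fun j => f j ^ Fintype.card K ^ e j) := by
  classical
  set ψ : MvPolynomial σ K →ₐ[K] MvPolynomial σ K :=
    aeval fun k => (X k : MvPolynomial σ K) ^ Fintype.card K ^ e k with hψ
  have hψinj : Function.Injective ψ :=
    algebraicIndependent_X_pow fun k => pow_ne_zero _ Fintype.card_ne_zero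
  obtain ⟨p, hp⟩ := CharP.exists K
  obtain ⟨a, hprime, hcard⟩ := FiniteField.card K p
  have : Fact p.Prime := ⟨hprime⟩
  have hrange : (Set.range fun j => f j ^ Fintype.card K ^ e j) = ψ '' Set.range (powRoot f e) := by
    rw [← Set.range_comp]
    exact congrArg Set.range (funext fun j => (aeval_powRoot hf j).symm)
  have hind : AlgebraicIndependent K (powRoot f e) := by
    refine AlgebraicIndependent.of_comp ψ ?_
    have h := hfind.polynomial_aeval_of_transcendental
      (f := fun j => Polynomial.X ^ Fintype.card K ^ e j) fun j =>
        (Polynomial.transcendental_X K).pow (pow_pos Fintype.card_pos _)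
    convert! h using 2 with j
    rw [Function.comp_apply, hψ, aeval_powRoot hf, map_pow, Polynomial.aeval_X]
  have hN : x ^ Fintype.card K ^ (∑ j, e j) ∈ Algebra.adjoin K (Set.range (powRoot f e)) := by
    -- A large power of `ψ x` is a polynomial in large powers of the `f j`.
    have h₁ : ψ x ^ Fintype.card K ^ (∑ j, e j) ∈
        Algebra.adjoin K (Set.range fun j => f j ^ Fintype.card K ^ e j) := by
      rw [← aeval_X_pow_card]
      have h₂ : aeval (fun k => (X k : MvPolynomial σ K) ^ Fintype.card K ^ (∑ j, e j)) (ψ x) ∈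
          (Algebra.adjoin K (Set.range f)).map (aeval fun k =>
            (X k : MvPolynomial σ K) ^ Fintype.card K ^ (∑ j, e j)) := ⟨ψ x, hx, rfl⟩
      rw [AlgHom.map_adjoin] at h₂
      refine Algebra.adjoin_le ?_ h₂
      rintro _ ⟨_, ⟨j, rfl⟩, rfl⟩
      have hle : e j ≤ ∑ j, e j :=
        Finset.single_le_sum (fun _ _ => Nat.zero_le _) (Finset.mem_univ j)
      have hj : f j ^ Fintype.card K ^ e j ∈
          Algebra.adjoin K (Set.range fun j => f j ^ Fintype.card K ^ e j) :=
        Algebra.subset_adjoin ⟨j, rfl⟩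
      rw [SetLike.mem_coe, aeval_X_pow_card, ← Nat.add_sub_cancel' hle, pow_add, pow_mul]
      exact pow_mem hj _
    rw [hrange, ← AlgHom.map_adjoin, ← map_pow] at h₁
    obtain ⟨y, hy, hyx⟩ := h₁
    rwa [← hψinj hyx]
  rw [hcard, ← pow_mul] at hN
  have hx' := mem_adjoin_of_pow_pow_mem p hind (det_jacobian_powRoot_ne_zero hf hJ) _ hN
  rw [hrange, ← AlgHom.map_adjoin]
  exact ⟨x, hx', rfl⟩

end Jacobian

/-! ### Invariants of finite groups -/

section OrbitPolynomial

open Polynomial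

variable {K A G : Type*} [CommRing K] [CommRing A] [IsDomain A] [Algebra K A] [Group G] [Finite G]

/-- The witness is `∏ (X - b)` over the distinct conjugates `b` of `a`. -/
lemma exists_invariant_polynomial (Φ : G → A →ₐ[K] A) (hone : ∀ a, Φ 1 a = a)
    (hmul : ∀ g h a, Φ h (Φ g a) = Φ (g * h) a) (a : A) :
    ∃ P : A[X], P ≠ 0 ∧ (∀ i g, Φ g (P.coeff i) = P.coeff i) ∧ P.eval a = 0 ∧
      P.derivative.eval a ≠ 0 := by
  classical
  have := Fintype.ofFinite G
  set s : Finset A := Finset.univ.image fun g => Φ g a with hs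
  have has : a ∈ s := Finset.mem_image.2 ⟨1, Finset.mem_univ _, hone a⟩
  have hinj : ∀ g, Function.Injective (Φ g) := fun g x y hxy => by
    have h := congrArg (Φ g⁻¹) hxy
    rwa [hmul, hmul, mul_inv_cancel, hone, hone] at h
  have himg : ∀ g, s.image (Φ g) = s := fun g => by
    refine Finset.eq_of_subset_of_card_le ?_ (Finset.card_image_of_injective s (hinj g)).ge
    intro b hb
    obtain ⟨c, hc, rfl⟩ := Finset.mem_image.1 hb
    obtain ⟨h, -, rfl⟩ := Finset.mem_image.1 hc
    exact Finset.mem_image.2 ⟨h * g, Finset.mem_univ _, (hmul _ _ _).symm⟩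
  refine ⟨∏ b ∈ s, (X - C b), (monic_prod_of_monic _ _ fun b _ => monic_X_sub_C b).ne_zero,
    fun i g => ?_, ?_, ?_⟩
  · have h : (∏ b ∈ s, (X - C b)).map (Φ g : A →+* A) = ∏ b ∈ s, (X - C b) := by
      conv_rhs => rw [← himg g]
      rw [Polynomial.map_prod, Finset.prod_image fun x _ y _ h => hinj g h]
      simp
    conv_rhs => rw [← h]
    rw [coeff_map]
    rfl
  · rw [eval_prod]
    exact Finset.prod_eq_zero has (by simp)
  · rw [← Finset.mul_prod_erase s _ has, derivative_mul, eval_add, eval_mul, eval_mul]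
    simp only [derivative_sub, derivative_X, derivative_C, sub_zero, eval_one, one_mul, eval_sub,
      eval_X, eval_C, sub_self, zero_mul, add_zero]
    rw [eval_prod, Finset.prod_ne_zero_iff]
    intro b hb
    rw [eval_sub, eval_X, eval_C, sub_ne_zero]
    exact (Finset.ne_of_mem_erase hb).symm

end OrbitPolynomial

section FiniteInvariants

variable {K V G : Type*} [Field K] [AddCommGroup V] [Module K V]

lemma coordPullback_linForm {V' : Type*} [AddCommGroup V'] [Module K V'] (T : V →ₗ[K] V')
    (φ : Dual K V') : coordPullback T (linForm φ) = linForm (φ ∘ₗ T) :=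
  SymmetricAlgebra.lift_ι_apply _ _

lemma coordRing_algHom_ext {A : Type*} [CommRing A] [Algebra K A] {Φ Ψ : CoordRing K V →ₐ[K] A}
    (h : ∀ φ, Φ (linForm φ) = Ψ (linForm φ)) : Φ = Ψ :=
  SymmetricAlgebra.algHom_ext (LinearMap.ext h)

lemma coordPullback_id (p : CoordRing K V) : coordPullback LinearMap.id p = p := by
  have h : coordPullback (LinearMap.id : V →ₗ[K] V) = AlgHom.id K _ :=
    coordRing_algHom_ext fun φ => by rw [coordPullback_linForm]; rfl
  rw [h, AlgHom.id_apply]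

lemma coordPullback_coordPullback {V' V'' : Type*} [AddCommGroup V'] [Module K V']
    [AddCommGroup V''] [Module K V''] (T : V →ₗ[K] V') (S : V' →ₗ[K] V'') (p : CoordRing K V'') :
    coordPullback T (coordPullback S p) = coordPullback (S ∘ₗ T) p := by
  have h : (coordPullback T).comp (coordPullback S) = coordPullback (S ∘ₗ T) :=
    coordRing_algHom_ext fun φ => by
      rw [AlgHom.comp_apply, coordPullback_linForm, coordPullback_linForm, coordPullback_linForm]
      rfl
  rw [← h, AlgHom.comp_apply]

variable [Group G] [Finite G] (ρ : Representation K G V)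

lemma exists_invariantRing_polynomial (a : CoordRing K V) :
    ∃ P : Polynomial (CoordRing K V), P ≠ 0 ∧ (∀ i, P.coeff i ∈ invariantRing ρ) ∧
      P.eval a = 0 ∧ P.derivative.eval a ≠ 0 :=
  exists_invariant_polynomial (fun g => coordPullback (ρ g))
    (fun a => by rw [map_one]; exact coordPullback_id a)
    (fun g h a => by rw [coordPullback_coordPullback, map_mul]; rfl) a

/-- `K[V]` is algebraic over its ring of invariants, so generators of the latter are algebraically
independent as soon as there are only `dim V` of them. -/
lemma algebraicIndependent_of_invariantRing_eq_adjoin [FiniteDimensional K V] {ι : Type*}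
    [Fintype ι] (c : ι → CoordRing K V) (hcard : Fintype.card ι = finrank K V)
    (hc : invariantRing ρ = Algebra.adjoin K (Set.range c)) : AlgebraicIndependent K c := by
  have halg : Algebra.IsAlgebraic (Algebra.adjoin K (Set.range c)) (CoordRing K V) := by
    refine ⟨fun a => ?_⟩
    obtain ⟨P, hP0, hPc, hPa, -⟩ := exists_invariantRing_polynomial ρ a
    have hlift : P ∈ Polynomial.lifts
        (algebraMap (Algebra.adjoin K (Set.range c)) (CoordRing K V)) := by
      rw [Polynomial.lifts_iff_coeff_lifts]
      intro i
      exact ⟨⟨P.coeff i, hc ▸ hPc i⟩, rfl⟩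
    obtain ⟨Q, rfl⟩ := hlift
    refine ⟨Q, ?_, ?_⟩
    · rintro rfl
      exact hP0 (by simp)
    · rw [Polynomial.aeval_def, ← Polynomial.eval_map]
      exact hPa
  refine (Algebra.IsAlgebraic.isTranscendenceBasis_of_lift_le_trdeg_of_finite K c ?_).1
  have h := (SymmetricAlgebra.equivMvPolynomial (finBasis K (Dual K V))).lift_trdeg_eq
  rw [MvPolynomial.trdeg_of_isDomain] at h
  simp only [Cardinal.mk_fin, Cardinal.lift_natCast, Subspace.dual_finrank_eq,
    Cardinal.lift_eq_nat_iff] at h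
  rw [Cardinal.mk_fintype, hcard, Cardinal.lift_natCast, h, Cardinal.lift_natCast]

/-- The extension `K(V) / K(V)^G` is separable, so a derivation of `K[V]` that kills the invariants
vanishes. -/
lemma derivation_eq_zero_of_invariantRing {D : Derivation K (CoordRing K V) (CoordRing K V)}
    (hD : ∀ a ∈ invariantRing ρ, D a = 0) (a : CoordRing K V) : D a = 0 := by
  obtain ⟨P, -, hPc, hPa, hP'⟩ := exists_invariantRing_polynomial ρ a
  have h := D.apply_eval_eq a P
  have hz : D.mapCoeffs P = 0 := by
    ext i
    exact hD _ (hPc i)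
  rw [hPa, map_zero, hz] at h
  rw [map_zero, zero_add, smul_eq_mul, eq_comm, mul_eq_zero] at h
  exact h.resolve_left hP'

open MvPolynomial in
/-- The Jacobian criterion for generators of a ring of invariants: a nonzero vector field killed by
all differentials `d f_j` would be a derivation that kills the invariants. -/
lemma det_jacobian_ne_zero_of_invariantRing_eq_adjoin {ι : Type*} [Fintype ι] [DecidableEq ι]
    (y : Basis ι K (Dual K V)) (f : ι → CoordRing K V)
    (hf : invariantRing ρ = Algebra.adjoin K (Set.range f)) :
    (jacobian fun j => SymmetricAlgebra.equivMvPolynomial y (f j)).det ≠ 0 := by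
  intro h0
  obtain ⟨v, hv, hJv⟩ := Matrix.exists_mulVec_eq_zero_iff.2 h0
  set e := SymmetricAlgebra.equivMvPolynomial y with he
  set D₀ : Derivation K (MvPolynomial ι K) (MvPolynomial ι K) := mkDerivation K v with hD₀
  have hD₀_apply : ∀ p, D₀ p = ∑ k, v k * pderiv k p := fun p => by
    simpa [hD₀, mkDerivation_X, mul_comm] using derivation_aeval D₀ X p
  let D : Derivation K (CoordRing K V) (CoordRing K V) :=
    Derivation.mk' (e.symm.toLinearMap ∘ₗ (D₀ : _ →ₗ[K] _) ∘ₗ e.toLinearMap) fun a b => by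
      simp
  have hD_apply : ∀ a, D a = e.symm (D₀ (e a)) := fun a => rfl
  have hDf : ∀ a ∈ invariantRing ρ, D a = 0 := by
    intro a ha
    rw [hf] at ha
    induction ha using Algebra.adjoin_induction with
    | mem x hx =>
      obtain ⟨j, rfl⟩ := hx
      have h := congrFun hJv j
      rw [hD_apply, hD₀_apply]
      have h' : ∑ k, v k * pderiv k (e (f j)) = 0 := by
        rw [← Pi.zero_apply (M := fun _ : ι => MvPolynomial ι K) j, ← h]
        exact Finset.sum_congr rfl fun k _ => mul_comm _ _
      rw [h', map_zero]
    | algebraMap r => exact D.map_algebraMap r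
    | add x y _ _ hx hy => rw [map_add, hx, hy, add_zero]
    | mul x y _ _ hx hy => rw [D.leibniz, hx, hy, smul_zero, smul_zero, add_zero]
  refine hv (funext fun k => ?_)
  have h := derivation_eq_zero_of_invariantRing ρ hDf (e.symm (X k))
  rw [hD_apply, AlgEquiv.apply_symm_apply, hD₀_apply, EmbeddingLike.map_eq_zero_iff,
    Finset.sum_eq_single k] at h
  · simpa using h
  · intro l _ hl
    rw [pderiv_X_of_ne hl.symm, mul_zero]
  · simp

end FiniteInvariants

/-! ### Products over the translates by a finite subspace -/

section Linearized

open Polynomial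

variable {K A U : Type*} [Field K] [Finite K] [CommRing A] [IsDomain A] [Algebra K A]
  [AddCommGroup U] [Module K U] [Fintype U]

omit [Finite K] in
lemma prod_add_linear_add (ι : U →ₗ[K] A) (hι : Function.Injective ι) (s t : A) :
    ∏ u, (s + t + ι u) = ∏ u, (s + ι u) + ∏ u, (t + ι u) := by
  classical
  set c := ∏ u, (s + ι u) with hc
  have hmon : ∀ a : A, (∏ u, (X + C (a + ι u))).Monic ∧
      (∏ u, (X + C (a + ι u))).natDegree = Fintype.card U := fun a =>
    ⟨monic_prod_of_monic _ _ fun u _ => monic_X_add_C _, by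
      rw [natDegree_prod_of_monic _ _ fun u _ => monic_X_add_C _]
      simp only [natDegree_X_add_C, Finset.sum_const, smul_eq_mul, mul_one, Finset.card_univ]⟩
  have hcard : (Finset.univ.image ι).card = Fintype.card U :=
    Finset.card_image_of_injective _ hι
  have key : ∏ u, (X + C (s + ι u)) - C c = ∏ u, (X + C (0 + ι u)) := by
    refine eq_of_degree_sub_lt_of_eval_finset_eq (Finset.univ.image ι) ?_ ?_
    · have h₁ : degree (∏ u, (X + C (s + ι u)) - ∏ u, (X + C (0 + ι u))) < Fintype.card U := by
        have h := degree_sub_lt_left (p := ∏ u, (X + C (s + ι u))) (q := ∏ u, (X + C (0 + ι u)))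
          (by rw [degree_eq_natDegree (hmon s).1.ne_zero, degree_eq_natDegree (hmon 0).1.ne_zero,
            (hmon s).2, (hmon 0).2]) (hmon s).1.ne_zero
          (by rw [(hmon s).1.leadingCoeff, (hmon 0).1.leadingCoeff])
        rwa [degree_eq_natDegree (hmon s).1.ne_zero, (hmon s).2] at h
      rw [hcard, sub_right_comm]
      refine (degree_sub_le _ _).trans_lt (max_lt h₁ (degree_C_le.trans_lt ?_))
      exact_mod_cast Fintype.card_pos
    · intro x hx
      obtain ⟨v, -, rfl⟩ := Finset.mem_image.1 hx
      have h0 : ∏ u, eval (ι v) (X + C (0 + ι u)) = 0 :=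
        Finset.prod_eq_zero (Finset.mem_univ (-v)) (by simp)
      rw [eval_sub, eval_C, eval_prod, eval_prod, h0, sub_eq_zero, hc]
      refine Fintype.prod_equiv (Equiv.addRight v) _ _ fun u => ?_
      simp only [eval_add, eval_X, eval_C, Equiv.coe_addRight, map_add]
      ring
  have h := congrArg (Polynomial.eval t) key
  simp only [eval_sub, eval_prod, eval_add, eval_X, eval_C, zero_add] at h
  rw [← h, add_sub_cancel]
  exact Finset.prod_congr rfl fun u _ => by ring

/-- The map `t ↦ ∏ u, (t + u)`, the product being over a finite `K`-subspace of a `K`-algebra `A`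
which is a domain. It is additive, because `∏ u, (X + s + u) - ∏ u, (s + u)` and `∏ u, (X + u)` are
monic of the same degree and have the same zeros; it is `K`-linear, because the number of factors
is a power of `|K|`. -/
def prodAddLinear (ι : U →ₗ[K] A) (hι : Function.Injective ι) : A →ₗ[K] A where
  toFun t := ∏ u, (t + ι u)
  map_add' := prod_add_linear_add ι hι
  map_smul' c t := by
    have := Fintype.ofFinite K
    by_cases hc : c = 0
    · subst hc
      rw [zero_smul, RingHom.id_apply, zero_smul]
      exact Finset.prod_eq_zero (Finset.mem_univ 0) (by simp)
    · have h₁ : ∏ u, (c • t + ι u) = ∏ u, c • (t + ι u) :=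
        (Fintype.prod_bijective (fun u => c • u)
          (MulAction.bijective (Units.mk0 c hc)) _ _ fun u => by rw [map_smul, smul_add]).symm
      rw [h₁, Finset.prod_smul, Finset.prod_const, Finset.card_univ, RingHom.id_apply,
        Module.card_eq_pow_finrank (K := K), FiniteField.pow_card_pow]

end Linearized

/-! ### Flags and the forms `f̃_j` -/

section Flag

variable {K W : Type*} [Field K] [AddCommGroup W] [Module K W]

lemma linForm_injective : Function.Injective (linForm (K := K) (V := W)) := by
  rw [← LinearMap.ker_eq_bot, LinearMap.ker_eq_bot']
  intro φ hφ
  ext w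
  have h := congrArg (SymmetricAlgebra.lift (Dual.eval K W w)) hφ
  rw [map_zero] at h
  exact (SymmetricAlgebra.lift_ι_apply (Dual.eval K W w) φ).symm.trans h

/-- The image of `(W / F_i)*` in `W*`. -/
abbrev flagDual (F : LTSeries (Submodule K W)) (i : Fin (F.length + 1)) : Submodule K (Dual K W) :=
  LinearMap.range (F i).mkQ.dualMap

variable {F : LTSeries (Submodule K W)}

lemma mem_flagDual {i : Fin (F.length + 1)} {φ : Dual K W} :
    φ ∈ flagDual F i ↔ ∀ w ∈ F i, φ w = 0 := by
  rw [flagDual, Submodule.range_dualMap_mkQ_eq, Submodule.mem_dualAnnihilator]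

lemma flagDual_antitone : Antitone (flagDual F) := fun _ _ hik _ hφ =>
  mem_flagDual.2 fun w hw => mem_flagDual.1 hφ w (F.monotone hik hw)

/-- The exponent `e` such that `f̃_j` has leading form `f_j ^ (q ^ e)`, where `q = |K|`: the
dimension of `W / F_i` if `r_i < j ≤ r_{i+1}`. -/
def flagExp (F : LTSeries (Submodule K W)) (j : ℕ) : ℕ := finrank K (flagDual F (flagIndex F j))

variable [FiniteDimensional K W] {n : ℕ}

lemma flagExp_le {j k : ℕ} (h : flagDim F (flagIndex F j) ≤ k) : flagExp F k ≤ flagExp F j :=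
  Submodule.finrank_mono (flagDual_antitone
    (Finset.le_sup (f := id) (Finset.mem_filter.2 ⟨Finset.mem_univ _, h⟩)))

omit [FiniteDimensional K W] in
lemma exists_flagIndex_eq (hF₀ : F.head = ⊥) (hF₁ : F.last = ⊤)
    (y : Basis (Fin n) K (Dual K W)) (j : Fin n) : ∃ i : Fin F.length,
      flagIndex F j = i.castSucc ∧ flagDim F i.castSucc ≤ j ∧ (j : ℕ) < flagDim F i.succ := by
  have hmem : flagIndex F j ∈ Finset.univ.filter fun i => flagDim F i ≤ (j : ℕ) := by
    have hne : (Finset.univ.filter fun i => flagDim F i ≤ (j : ℕ)).Nonempty := by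
      refine ⟨0, Finset.mem_filter.2 ⟨Finset.mem_univ _, ?_⟩⟩
      have h0 : F 0 = ⊥ := hF₀
      rw [flagDim, h0, finrank_bot]
      exact Nat.zero_le _
    obtain ⟨i, hi, hsup⟩ := Finset.exists_mem_eq_sup _ hne id
    rw [flagIndex, hsup]
    exact hi
  have hle := (Finset.mem_filter.1 hmem).2
  have hn : finrank K W = n := by
    rw [← Subspace.dual_finrank_eq, finrank_eq_card_basis y, Fintype.card_fin]
  have hlast : flagIndex F j ≠ Fin.last _ := fun h => by
    have hl : F (Fin.last _) = ⊤ := hF₁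
    rw [h, flagDim, hl, finrank_top, hn] at hle
    omega
  obtain ⟨i, hi⟩ := Fin.exists_castSucc_eq.2 hlast
  refine ⟨i, hi.symm, hi ▸ hle, ?_⟩
  by_contra! hlt
  have h : i.succ ≤ flagIndex F j :=
    Finset.le_sup (f := id) (Finset.mem_filter.2 ⟨Finset.mem_univ _, hlt⟩)
  rw [← hi] at h
  exact absurd h (not_le.2 (Fin.castSucc_lt_succ))

omit [FiniteDimensional K W] in
lemma IsFlagBasis.mem_flagDual {y : Basis (Fin n) K (Dual K W)} (hy : IsFlagBasis F y)
    {i : Fin (F.length + 1)} {k : Fin n} (hk : flagDim F i ≤ k) : y k ∈ flagDual F i := by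
  rw [flagDual, ← hy i]
  exact Submodule.subset_span ⟨k, hk, rfl⟩

variable [Finite K]

instance : Finite (Dual K W) := Module.finite_of_finite K

/-- The forms in `(W / F_i)*`, as elements of `K[W₂] ⊆ K[W₁ ⊕ W₂]`. -/
def flagDualForm (F : LTSeries (Submodule K W)) (i : Fin (F.length + 1)) :
    flagDual F i →ₗ[K] CoordRing K (W × W) :=
  linForm ∘ₗ (LinearMap.snd K W W).dualMap ∘ₗ (flagDual F i).subtype

omit [FiniteDimensional K W] [Finite K] in
lemma flagDualForm_injective (i : Fin (F.length + 1)) :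
    Function.Injective (flagDualForm F i) :=
  linForm_injective.comp ((LinearMap.dualMap_injective_of_surjective
    LinearMap.snd_surjective).comp Subtype.val_injective)

/-- `flagNorm` as a linear map in the linear form `y`. -/
def flagNormLinear (F : LTSeries (Submodule K W)) (i : Fin (F.length + 1)) :
    Dual K W →ₗ[K] CoordRing K (W × W) :=
  letI := Fintype.ofFinite (flagDual F i)
  prodAddLinear (K := K) (A := CoordRing K (W × W)) (U := flagDual F i) (flagDualForm F i)
      (flagDualForm_injective i) ∘ₗ
    linForm ∘ₗ (LinearMap.fst K W W).dualMap

omit [FiniteDimensional K W] [Finite K] in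
lemma flagNorm_eq_prod [Fintype (flagDual F i)] (y : Dual K W) :
    flagNorm F i y = ∏ u : flagDual F i, (linForm (y ∘ₗ LinearMap.fst K W W) +
      linForm ((u : Dual K W) ∘ₗ LinearMap.snd K W W)) :=
  finprod_eq_prod_of_fintype _

lemma flagNormLinear_apply (i : Fin (F.length + 1)) (y : Dual K W) :
    flagNormLinear F i y = flagNorm F i y := by
  let _ := Fintype.ofFinite (flagDual F i)
  rw [flagNorm_eq_prod]
  rfl

lemma flagTilde_eq (y : Basis (Fin n) K (Dual K W)) (f : Fin n → CoordRing K W) (j : Fin n) :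
    flagTilde F y f j = SymmetricAlgebra.lift (flagNormLinear F (flagIndex F j)) (f j) := by
  rw [flagTilde]
  congr 2
  exact y.ext fun k => by rw [Basis.constr_basis, flagNormLinear_apply]

variable {G₁ G₂ : Subgroup (parabolicSubgroup F)}

instance : Finite (W →ₗ[K] W) := Module.finite_of_finite K

instance : Finite (LinearMap.GeneralLinearGroup K W) :=
  Finite.of_injective (fun g => (g : W →ₗ[K] W)) Units.val_injective

instance : Finite (ParabolicGluing G₁ G₂) :=
  Finite.of_injective (fun a => (a.fst, a.hom, a.snd)) fun a b h => by
    simp only [Prod.mk.injEq] at h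
    exact Gluing.ext h.1 h.2.1 h.2.2

omit [FiniteDimensional K W] [Finite K] in
lemma rep_pullback_fst (a : ParabolicGluing G₁ G₂) (y : Dual K W) :
    coordPullback (Gluing.rep _ a) (linForm (y ∘ₗ LinearMap.fst K W W)) =
      linForm ((y ∘ₗ naturalRep G₁ a.fst) ∘ₗ LinearMap.fst K W W) +
        linForm ((y ∘ₗ a.hom) ∘ₗ LinearMap.snd K W W) := by
  rw [coordPullback_linForm, ← map_add]
  congr 1
  ext w <;> simp [Gluing.rep]

omit [FiniteDimensional K W] [Finite K] in
lemma rep_pullback_snd (a : ParabolicGluing G₁ G₂) (y : Dual K W) :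
    coordPullback (Gluing.rep _ a) (linForm (y ∘ₗ LinearMap.snd K W W)) =
      linForm ((y ∘ₗ naturalRep G₂ a.snd) ∘ₗ LinearMap.snd K W W) := by
  rw [coordPullback_linForm]
  congr 1

omit [FiniteDimensional K W] [Finite K] in
lemma comp_naturalRep_mem_flagDual {i : Fin (F.length + 1)} (g : G₁) {u : Dual K W}
    (hu : u ∈ flagDual F i) : u ∘ₗ naturalRep G₁ g ∈ flagDual F i :=
  mem_flagDual.2 fun w hw => mem_flagDual.1 hu _ ((g.1.2 i).le ⟨w, hw, rfl⟩)

lemma rep_pullback_flagNorm (a : ParabolicGluing G₁ G₂) {i : Fin (F.length + 1)} {y : Dual K W}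
    (hy : y ∈ flagDual F i) :
    coordPullback (Gluing.rep _ a) (flagNorm F i y) =
      flagNorm F i (y ∘ₗ naturalRep G₁ a.fst) := by
  let _ := Fintype.ofFinite (flagDual F i)
  have hhom : y ∘ₗ a.hom ∈ flagDual F i :=
    mem_flagDual.2 fun w hw => mem_flagDual.1 hy _ (a.hom_mem i ⟨w, hw, rfl⟩)
  rw [flagNorm_eq_prod, flagNorm_eq_prod, map_prod]
  set τ : flagDual F i → flagDual F i := fun u =>
    ⟨y ∘ₗ a.hom + u ∘ₗ naturalRep G₂ a.snd,
      add_mem hhom (comp_naturalRep_mem_flagDual a.snd u.2)⟩ with hτ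
  have hinj : Function.Injective τ := fun u v huv => by
    have h : (u : Dual K W) ∘ₗ naturalRep G₂ a.snd = v ∘ₗ naturalRep G₂ a.snd :=
      add_left_cancel (congrArg Subtype.val huv)
    refine Subtype.ext (LinearMap.ext fun w => ?_)
    have h' := LinearMap.congr_fun h (naturalRep G₂ a.snd⁻¹ w)
    simpa using h'
  refine Fintype.prod_bijective τ (Finite.injective_iff_bijective.1 hinj) _ _ fun u => ?_
  rw [map_add, rep_pullback_fst, rep_pullback_snd, add_assoc, ← map_add linForm,
    ← LinearMap.add_comp]

/-- Each `f̃_j` is invariant: on the linear forms `y` that vanish on `F_i` the map `flagNorm F i`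
is linear and intertwines the action of the gluing with that of `G₁`, and `f_j` is a `G₁`-invariant
polynomial in such forms. -/
lemma flagTilde_mem_invariantRing (hF₀ : F.head = ⊥) (hF₁ : F.last = ⊤)
    {y : Basis (Fin n) K (Dual K W)} (hy : IsFlagBasis F y) {f : Fin n → CoordRing K W}
    (hf : IsFlagConsistent F y f) (j : Fin n) (hj : f j ∈ invariantRing (naturalRep G₁)) :
    flagTilde F y f j ∈ invariantRing (Gluing.rep (flagBimodule G₁ G₂)) := by
  intro a
  obtain ⟨i, hi, hij, hji⟩ := exists_flagIndex_eq hF₀ hF₁ y j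
  rw [flagTilde_eq, hi, ← AlgHom.comp_apply]
  conv_rhs => rw [← hj a.fst, ← AlgHom.comp_apply]
  refine (AlgHom.adjoin_le_equalizer _ _ ?_) (hf.2 i j hij hji)
  rintro _ ⟨k, hk, rfl⟩
  have hlift : ∀ φ, SymmetricAlgebra.lift (flagNormLinear F i.castSucc) (linForm φ) =
      flagNorm F i.castSucc φ := fun φ =>
    (SymmetricAlgebra.lift_ι_apply _ _).trans (flagNormLinear_apply _ _)
  simp only [AlgHom.comp_apply]
  rw [coordPullback_linForm, hlift, hlift, rep_pullback_flagNorm a (hy.mem_flagDual hk)]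

end Flag

/-! ### Extension of scalars for polynomials -/

section CoeffFunctional

open MvPolynomial

variable {σ K R : Type*} [Field K] [CommRing R] [Algebra K R]

/-- A `K`-linear functional on `R`, applied to the coefficients of a polynomial over `R`. -/
def coeffFunctional (l : R →ₗ[K] K) : MvPolynomial σ R →ₗ[K] MvPolynomial σ K :=
  (basisMonomials σ K).repr.symm.toLinearMap ∘ₗ Finsupp.mapRange.linearMap l ∘ₗ
    ((basisMonomials σ R).repr.toLinearMap.restrictScalars K)

@[simp]
lemma coeff_coeffFunctional (l : R →ₗ[K] K) (F : MvPolynomial σ R) (α : σ →₀ ℕ) :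
    coeff α (coeffFunctional l F) = l (coeff α F) := by
  change (basisMonomials σ K).repr ((basisMonomials σ K).repr.symm _) α = _
  rw [LinearEquiv.apply_symm_apply]
  rfl

lemma coeffFunctional_C_mul_map (l : R →ₗ[K] K) (r : R) (p : MvPolynomial σ K) :
    coeffFunctional l (C r * map (algebraMap K R) p) = l r • p := by
  ext α
  rw [coeff_coeffFunctional, coeff_C_mul, coeff_map, mul_comm, ← Algebra.smul_def, map_smul,
    coeff_smul, smul_eq_mul, smul_eq_mul, mul_comm]

lemma sum_C_mul_map_monomial (F : MvPolynomial σ R) :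
    F = ∑ α ∈ F.support, C (coeff α F) * map (algebraMap K R) (monomial α 1) := by
  conv_lhs => rw [F.as_sum]
  refine Finset.sum_congr rfl fun α _ => ?_
  rw [map_monomial, map_one, C_mul_monomial, mul_one]

lemma coeffFunctional_aeval (l : R →ₗ[K] K) {τ : Type*} (s : σ → MvPolynomial τ K)
    (F : MvPolynomial σ R) :
    coeffFunctional l (aeval (fun k => map (algebraMap K R) (s k)) F) =
      aeval s (coeffFunctional l F) := by
  have hmap : ∀ p : MvPolynomial σ K, aeval (fun k => map (algebraMap K R) (s k))
      (map (algebraMap K R) p) = map (algebraMap K R) (aeval s p) := fun p => by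
    induction p using MvPolynomial.induction_on with
    | C a => simp [← MvPolynomial.algebraMap_eq]
    | add p q hp hq => simp only [map_add, hp, hq]
    | mul_X p i hp => simp only [map_mul, hp, map_X, aeval_X]
  conv_lhs => rw [sum_C_mul_map_monomial (K := K) F]
  conv_rhs => rw [sum_C_mul_map_monomial (K := K) F]
  simp only [map_sum]
  refine Finset.sum_congr rfl fun α _ => ?_
  rw [map_mul, hmap, coeffFunctional_C_mul_map, map_smul, ← MvPolynomial.algebraMap_eq,
    AlgHom.commutes, MvPolynomial.algebraMap_eq, coeffFunctional_C_mul_map]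

lemma eq_of_coeffFunctional_eq {F F' : MvPolynomial σ R}
    (h : ∀ l : R →ₗ[K] K, coeffFunctional l F = coeffFunctional l F') : F = F' := by
  ext α
  rw [← sub_eq_zero, ← Module.forall_dual_apply_eq_zero_iff K]
  intro l
  rw [map_sub, ← coeff_coeffFunctional, ← coeff_coeffFunctional, h l, sub_self]

/-- If all functionals on `R` send `F` into a subspace `T` of `K[X]`, then `F` lies in `R ⊗ T`: it
is fixed by `id ⊗ π`, where `π` is a projection onto `T`. The coefficients of the resulting
expression are those of `F`. -/
lemma exists_projection_of_coeffFunctional_mem (T : Submodule K (MvPolynomial σ K))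
    (F : MvPolynomial σ R) (h : ∀ l : R →ₗ[K] K, coeffFunctional l F ∈ T) :
    ∃ π : (σ →₀ ℕ) → MvPolynomial σ K, (∀ α, π α ∈ T) ∧
      F = ∑ α ∈ F.support, C (coeff α F) * map (algebraMap K R) (π α) := by
  obtain ⟨π, hπ⟩ := LinearMap.exists_leftInverse_of_injective T.subtype T.ker_subtype
  refine ⟨fun α => π (monomial α 1), fun α => (π _).2, eq_of_coeffFunctional_eq (K := K)
    fun l => ?_⟩
  have hfix : ((π (coeffFunctional l F) : T) : MvPolynomial σ K) = coeffFunctional l F :=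
    congrArg Subtype.val (LinearMap.congr_fun hπ ⟨coeffFunctional l F, h l⟩)
  rw [← hfix]
  conv_lhs => rw [sum_C_mul_map_monomial (K := K) F]
  simp only [map_sum, coeffFunctional_C_mul_map, map_smul, AddSubmonoidClass.coe_finsetSum,
    Submodule.coe_smul]

end CoeffFunctional

section LinearSubstitution

open MvPolynomial

variable {σ R : Type*} [CommRing R]

/-- A linear substitution respects leading forms. -/
lemma HasLead.aeval_linear {τ : Type*} {d : ℕ} {F P : MvPolynomial σ R} (h : HasLead d F P)
    {s : σ → MvPolynomial τ R} (hs : ∀ k, (s k).IsHomogeneous 1) :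
    HasLead d (MvPolynomial.aeval s F) (MvPolynomial.aeval s P) := by
  have hlow : HasLead d (MvPolynomial.aeval (R := R) s (F - P)) 0 := by
    rw [(F - P).as_sum, map_sum, ← Finset.sum_const_zero (s := (F - P).support)]
    refine HasLead.sum _ fun α hα => ?_
    have hlt : α.degree < d := by
      by_contra! hle
      exact (MvPolynomial.mem_support_iff.1 hα) (by rw [coeff_sub, h.2 α hle, sub_self])
    have hhom : (MvPolynomial.aeval s (monomial α (coeff α (F - P)))).IsHomogeneous α.degree := by
      have h' := (isHomogeneous_monomial (coeff α (F - P)) (rfl : α.degree = _)).aeval s hs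
      rwa [one_mul] at h'
    exact ⟨isHomogeneous_zero _ _ _, fun β hβ => by
      rw [hhom.coeff_eq_zero (by omega), coeff_zero]⟩
  have hP : HasLead d (MvPolynomial.aeval s P) (MvPolynomial.aeval s P) :=
    HasLead.of_isHomogeneous (by simpa only [one_mul] using h.1.aeval s hs)
  simpa using hlow.add hP

lemma HasLead.map {S : Type*} [CommRing S] (φ : R →+* S) {d : ℕ} {F P : MvPolynomial σ R}
    (h : HasLead d F P) : HasLead d (MvPolynomial.map φ F) (MvPolynomial.map φ P) :=
  ⟨h.1.map φ, fun α hα => by rw [coeff_map, coeff_map, h.2 α hα]⟩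

lemma mem_range_aeval_X_pow {m : σ → ℕ} {F : MvPolynomial σ R}
    (h : ∀ α ∈ F.support, ∀ k, m k ∣ α k) :
    ∃ x : MvPolynomial σ R, aeval (fun k => (X k : MvPolynomial σ R) ^ m k) x = F := by
  suffices hmem : F ∈ (aeval (R := R) fun k => (X k : MvPolynomial σ R) ^ m k).range from hmem
  rw [F.as_sum]
  refine sum_mem fun α hα => ?_
  rw [monomial_eq, ← MvPolynomial.algebraMap_eq]
  refine mul_mem (Subalgebra.algebraMap_mem _ _) (prod_mem fun k _ => ?_)
  obtain ⟨c, hc⟩ := h α hα k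
  refine ⟨X k ^ c, ?_⟩
  change aeval _ (X k ^ c) = _
  rw [map_pow, aeval_X, ← pow_mul, hc]

end LinearSubstitution

/-! ### Coordinates on `W₁`, with coefficients in `K[W₂]` -/

section Coordinates

open MvPolynomial

variable {K W : Type*} [Field K] [AddCommGroup W] [Module K W] {ι : Type*}

/-- A linear form on `W₁` as a homogeneous polynomial of degree `1` in the coordinates `y`. -/
def coordLinear (y : Basis ι K (Dual K W)) : Dual K W →ₗ[K] MvPolynomial ι K :=
  y.constr K X

lemma equivMvPolynomial_linForm (y : Basis ι K (Dual K W)) (φ : Dual K W) :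
    SymmetricAlgebra.equivMvPolynomial y (linForm φ) = coordLinear y φ :=
  SymmetricAlgebra.lift_ι_apply _ _

lemma coordLinear_basis (y : Basis ι K (Dual K W)) (k : ι) : coordLinear y (y k) = X k :=
  y.constr_basis _ _ _

lemma coordLinear_isHomogeneous (y : Basis ι K (Dual K W)) (φ : Dual K W) :
    (coordLinear y φ).IsHomogeneous 1 := by
  rw [coordLinear, Basis.constr_apply]
  refine IsHomogeneous.sum _ _ _ fun k _ => ?_
  simp only [smul_eq_C_mul]
  exact isHomogeneous_C_mul_X _ _

lemma IsHomogeneousForm.isHomogeneous (y : Basis ι K (Dual K W)) {f : CoordRing K W}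
    (hf : IsHomogeneousForm f) :
    ∃ d, (SymmetricAlgebra.equivMvPolynomial y f).IsHomogeneous d := by
  obtain ⟨d, hd⟩ := hf
  refine ⟨d, ?_⟩
  induction hd using Submodule.pow_induction_on_left' with
  | algebraMap r =>
    rw [AlgEquiv.commutes]
    exact isHomogeneous_C _ _
  | add x y i _ _ hx hy => rw [map_add]; exact hx.add hy
  | mem_mul m hm i x _ hx =>
    obtain ⟨φ, rfl⟩ := hm
    rw [map_mul, equivMvPolynomial_linForm, Nat.succ_eq_add_one, add_comm]
    exact (coordLinear_isHomogeneous y φ).mul hx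

/-- `K[W₁ ⊕ W₂]` as the polynomial ring over `K[W₂]` in the coordinates `y` of `W₁`. -/
def toPolyFst (y : Basis ι K (Dual K W)) :
    CoordRing K (W × W) →ₐ[K] MvPolynomial ι (CoordRing K W) :=
  SymmetricAlgebra.lift
    ((mapAlgHom (Algebra.ofId K (CoordRing K W))).toLinearMap ∘ₗ coordLinear y ∘ₗ
        (LinearMap.inl K W W).dualMap +
      (IsScalarTower.toAlgHom K (CoordRing K W) (MvPolynomial ι (CoordRing K W))).toLinearMap ∘ₗ
        linForm ∘ₗ (LinearMap.inr K W W).dualMap)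

lemma toPolyFst_fst (y : Basis ι K (Dual K W)) (φ : Dual K W) :
    toPolyFst y (linForm (φ ∘ₗ LinearMap.fst K W W)) =
      map (algebraMap K (CoordRing K W)) (coordLinear y φ) := by
  have h₁ : (LinearMap.inl K W W).dualMap (φ ∘ₗ LinearMap.fst K W W) = φ := by ext; simp
  have h₂ : (LinearMap.inr K W W).dualMap (φ ∘ₗ LinearMap.fst K W W) = 0 := by ext; simp
  refine (SymmetricAlgebra.lift_ι_apply _ _).trans ?_
  simp only [LinearMap.add_apply, LinearMap.comp_apply, h₁, h₂, map_zero, add_zero]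
  rfl

lemma toPolyFst_snd (y : Basis ι K (Dual K W)) (φ : Dual K W) :
    toPolyFst y (linForm (φ ∘ₗ LinearMap.snd K W W)) = C (linForm φ) := by
  have h₁ : (LinearMap.inl K W W).dualMap (φ ∘ₗ LinearMap.snd K W W) = 0 := by ext; simp
  have h₂ : (LinearMap.inr K W W).dualMap (φ ∘ₗ LinearMap.snd K W W) = φ := by ext; simp
  refine (SymmetricAlgebra.lift_ι_apply _ _).trans ?_
  simp only [LinearMap.add_apply, LinearMap.comp_apply, h₁, h₂, map_zero, zero_add]
  rfl

lemma toPolyFst_basis (y : Basis ι K (Dual K W)) (k : ι) :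
    toPolyFst y (linForm (y k ∘ₗ LinearMap.fst K W W)) = X k := by
  rw [toPolyFst_fst, coordLinear_basis, map_X]

lemma toPolyFst_inclSnd (y : Basis ι K (Dual K W)) (r : CoordRing K W) :
    toPolyFst y (inclSnd r) = C r := by
  have h : (toPolyFst y).comp inclSnd =
      IsScalarTower.toAlgHom K (CoordRing K W) (MvPolynomial ι (CoordRing K W)) :=
    coordRing_algHom_ext fun φ => by
      rw [AlgHom.comp_apply, inclSnd, coordPullback_linForm, toPolyFst_snd]
      rfl
  exact DFunLike.congr_fun h r

lemma algHom_ext_prod {A : Type*} [CommRing A] [Algebra K A] (y : Basis ι K (Dual K W))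
    {Φ Ψ : CoordRing K (W × W) →ₐ[K] A}
    (h₁ : ∀ k, Φ (linForm (y k ∘ₗ LinearMap.fst K W W)) =
      Ψ (linForm (y k ∘ₗ LinearMap.fst K W W)))
    (h₂ : ∀ φ, Φ (linForm (φ ∘ₗ LinearMap.snd K W W)) =
      Ψ (linForm (φ ∘ₗ LinearMap.snd K W W))) : Φ = Ψ := by
  have h₁' : Φ.toLinearMap ∘ₗ linForm ∘ₗ (LinearMap.fst K W W).dualMap =
      Ψ.toLinearMap ∘ₗ linForm ∘ₗ (LinearMap.fst K W W).dualMap := y.ext h₁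
  refine coordRing_algHom_ext fun φ => ?_
  have hφ : φ = (φ ∘ₗ LinearMap.inl K W W) ∘ₗ LinearMap.fst K W W +
      (φ ∘ₗ LinearMap.inr K W W) ∘ₗ LinearMap.snd K W W := by
    ext <;> simp <;> exact map_zero φ
  rw [hφ, map_add, map_add, map_add, h₂]
  congr 1
  exact LinearMap.congr_fun h₁' (φ ∘ₗ LinearMap.inl K W W)

lemma toPolyFst_injective (y : Basis ι K (Dual K W)) : Function.Injective (toPolyFst y) := by
  have h : (aevalTower inclSnd fun k => linForm (y k ∘ₗ LinearMap.fst K W W)).comp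
      (toPolyFst y) = AlgHom.id K (CoordRing K (W × W)) := by
    refine algHom_ext_prod y (fun k => ?_) fun φ => ?_
    · rw [AlgHom.comp_apply, toPolyFst_basis, aevalTower_X, AlgHom.id_apply]
    · rw [AlgHom.comp_apply, toPolyFst_snd, aevalTower_C, AlgHom.id_apply, inclSnd,
        coordPullback_linForm]
  exact Function.LeftInverse.injective (g := aevalTower inclSnd fun k =>
    linForm (y k ∘ₗ LinearMap.fst K W W)) fun p => DFunLike.congr_fun h p

end Coordinates

/-! ### Leading forms of invariants of the gluing -/

section LeadingFormsOfInvariants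

open MvPolynomial

variable {K W : Type*} [Field K] [AddCommGroup W] [Module K W] {F : LTSeries (Submodule K W)}
  {G₁ G₂ : Subgroup (parabolicSubgroup F)} {n : ℕ}

/-- The elements `(g₁, 0, 1)` act by linear substitutions with coefficients in `K`. -/
lemma toPolyFst_rep_fst {ι : Type*} (y : Basis ι K (Dual K W)) (a : ParabolicGluing G₁ G₂)
    (hhom : a.hom = 0) (hsnd : a.snd = 1) (p : CoordRing K (W × W)) :
    toPolyFst y (coordPullback (Gluing.rep _ a) p) =
      aeval (fun k => map (algebraMap K (CoordRing K W))
        (coordLinear y (y k ∘ₗ naturalRep G₁ a.fst))) (toPolyFst y p) := by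
  have h : (toPolyFst y).comp (coordPullback (Gluing.rep _ a)) =
      (AlgHom.restrictScalars K (aeval fun k => map (algebraMap K (CoordRing K W))
        (coordLinear y (y k ∘ₗ naturalRep G₁ a.fst)))).comp (toPolyFst y) := by
    refine algHom_ext_prod y (fun k => ?_) fun φ => ?_
    · rw [AlgHom.comp_apply, AlgHom.comp_apply, rep_pullback_fst, hhom, LinearMap.comp_zero,
        LinearMap.zero_comp, map_zero, add_zero, toPolyFst_fst, toPolyFst_basis,
        AlgHom.restrictScalars_apply, aeval_X]
    · rw [AlgHom.comp_apply, AlgHom.comp_apply, rep_pullback_snd, hsnd, map_one, toPolyFst_snd,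
        toPolyFst_snd, AlgHom.restrictScalars_apply, ← MvPolynomial.algebraMap_eq,
        AlgHom.commutes]
      rfl
  exact DFunLike.congr_fun h p

/-- The elements `(1, 0, g₂)` act on the coefficients. -/
lemma toPolyFst_rep_snd {ι : Type*} (y : Basis ι K (Dual K W)) (a : ParabolicGluing G₁ G₂)
    (hfst : a.fst = 1) (hhom : a.hom = 0) (p : CoordRing K (W × W)) :
    toPolyFst y (coordPullback (Gluing.rep _ a) p) =
      map (coordPullback (naturalRep G₂ a.snd) : CoordRing K W →+* CoordRing K W)
        (toPolyFst y p) := by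
  have h : (toPolyFst y).comp (coordPullback (Gluing.rep _ a)) =
      (mapAlgHom (coordPullback (naturalRep G₂ a.snd))).comp (toPolyFst y) := by
    refine algHom_ext_prod y (fun k => ?_) fun φ => ?_
    · rw [AlgHom.comp_apply, AlgHom.comp_apply, rep_pullback_fst, hhom, LinearMap.comp_zero,
        LinearMap.zero_comp, map_zero, add_zero, hfst, map_one, toPolyFst_basis, mapAlgHom_apply]
      refine Eq.trans ?_ (map_X _ k).symm
      exact toPolyFst_basis y k
    · rw [AlgHom.comp_apply, AlgHom.comp_apply, rep_pullback_snd, toPolyFst_snd,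
        toPolyFst_snd, mapAlgHom_apply]
      refine Eq.trans ?_ (map_C _ _).symm
      exact congrArg C (coordPullback_linForm _ _).symm
  exact DFunLike.congr_fun h p

/-- The elements `(1, φ, 1)` with `y_k ∘ φ = 0` for all `k ≠ j` translate the variable `X j`. -/
lemma toPolyFst_rep_hom {ι : Type*} [DecidableEq ι] (y : Basis ι K (Dual K W))
    (a : ParabolicGluing G₁ G₂) (hfst : a.fst = 1) (hsnd : a.snd = 1) (j : ι)
    (hne : ∀ k, k ≠ j → y k ∘ₗ a.hom = 0) (p : CoordRing K (W × W)) :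
    toPolyFst y (coordPullback (Gluing.rep _ a) p) =
      substVar j (X j + C (linForm (y j ∘ₗ a.hom))) (toPolyFst y p) := by
  have h : (toPolyFst y).comp (coordPullback (Gluing.rep _ a)) =
      (AlgHom.restrictScalars K (substVar j (X j + C (linForm (y j ∘ₗ a.hom))))).comp
        (toPolyFst y) := by
    refine algHom_ext_prod y (fun k => ?_) fun φ => ?_
    · rw [AlgHom.comp_apply, AlgHom.comp_apply, rep_pullback_fst, hfst, map_one, map_add,
        toPolyFst_snd, toPolyFst_basis, AlgHom.restrictScalars_apply]
      have h1 : toPolyFst y (linForm ((y k ∘ₗ (1 : W →ₗ[K] W)) ∘ₗ LinearMap.fst K W W)) = X k :=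
        toPolyFst_basis y k
      rw [h1]
      by_cases hk : k = j
      · subst hk; rw [substVar_X_self]
      · rw [substVar_X_of_ne _ hk, hne k hk, map_zero, C_0, add_zero]
    · rw [AlgHom.comp_apply, AlgHom.comp_apply, rep_pullback_snd, hsnd, map_one, toPolyFst_snd,
        toPolyFst_snd, AlgHom.restrictScalars_apply, ← MvPolynomial.algebraMap_eq,
        AlgHom.commutes]
      rfl
  exact DFunLike.congr_fun h p

lemma equivMvPolynomial_coordPullback {ι : Type*} (y : Basis ι K (Dual K W)) (T : W →ₗ[K] W)
    (p : CoordRing K W) :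
    SymmetricAlgebra.equivMvPolynomial y (coordPullback T p) =
      aeval (fun k => coordLinear y (y k ∘ₗ T)) (SymmetricAlgebra.equivMvPolynomial y p) := by
  have h : (SymmetricAlgebra.equivMvPolynomial y).toAlgHom.comp (coordPullback T) =
      (aeval fun k => coordLinear y (y k ∘ₗ T)).comp
        (SymmetricAlgebra.equivMvPolynomial y).toAlgHom := by
    have h₁ : coordLinear y ∘ₗ T.dualMap =
        (aeval fun k => coordLinear y (y k ∘ₗ T)).toLinearMap ∘ₗ coordLinear y := by
      refine y.ext fun k => ?_
      simp only [LinearMap.comp_apply, AlgHom.toLinearMap_apply]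
      rw [coordLinear_basis, aeval_X]
      rfl
    refine coordRing_algHom_ext fun φ => ?_
    have h₂ := LinearMap.congr_fun h₁ φ
    change SymmetricAlgebra.equivMvPolynomial y (coordPullback T (linForm φ)) =
      aeval _ (SymmetricAlgebra.equivMvPolynomial y (linForm φ))
    rw [coordPullback_linForm, equivMvPolynomial_linForm, equivMvPolynomial_linForm]
    exact h₂
  exact DFunLike.congr_fun h p

variable {y : Basis (Fin n) K (Dual K W)} {p : CoordRing K (W × W)} {d : ℕ}
  {P : MvPolynomial (Fin n) (CoordRing K W)}

lemma coeff_mem_invariantRing_of_hasLead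
    (hp : p ∈ invariantRing (Gluing.rep (flagBimodule G₁ G₂)))
    (hP : HasLead d (toPolyFst y p) P) (α : Fin n →₀ ℕ) :
    coeff α P ∈ invariantRing (naturalRep G₂) := by
  intro g
  have h := hP.map (coordPullback (naturalRep G₂ g) : CoordRing K W →+* CoordRing K W)
  rw [← toPolyFst_rep_snd y ⟨1, 0, g, (flagBimodule G₁ G₂).zero_mem⟩ rfl rfl, hp] at h
  have h' := congrArg (coeff α) (h.eq hP)
  rwa [coeff_map] at h'

lemma coeffFunctional_mem_invariantRing_of_hasLead
    (hp : p ∈ invariantRing (Gluing.rep (flagBimodule G₁ G₂)))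
    (hP : HasLead d (toPolyFst y p) P) (l : CoordRing K W →ₗ[K] K) :
    (SymmetricAlgebra.equivMvPolynomial y).symm (coeffFunctional l P) ∈
      invariantRing (naturalRep G₁) := by
  intro g
  have h := hP.aeval_linear (s := fun k => map (algebraMap K (CoordRing K W))
    (coordLinear y (y k ∘ₗ naturalRep G₁ g))) fun k => (coordLinear_isHomogeneous y _).map _
  rw [← toPolyFst_rep_fst y ⟨g, 0, 1, (flagBimodule G₁ G₂).zero_mem⟩ rfl rfl, hp] at h
  have h' := congrArg (coeffFunctional l) (h.eq hP)
  rw [coeffFunctional_aeval] at h'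
  apply (SymmetricAlgebra.equivMvPolynomial y).injective
  rw [equivMvPolynomial_coordPullback, AlgEquiv.apply_symm_apply, h']

lemma card_flagDual_pow [Fintype K] [FiniteDimensional K W] (j : ℕ)
    [Fintype (flagDual F (flagIndex F j))] :
    Fintype.card (flagDual F (flagIndex F j)) = Fintype.card K ^ flagExp F j :=
  Module.card_eq_pow_finrank (K := K) (V := flagDual F (flagIndex F j))

/-- The transvections `φ` of rank one in `M_F` translate the single variable `y_j` by an arbitrary
form in `(W / F_i)*`, where `r_i < j ≤ r_{i+1}`. -/
lemma card_dvd_of_hasLead [Fintype K] [FiniteDimensional K W] (hF₀ : F.head = ⊥)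
    (hF₁ : F.last = ⊤) (hy : IsFlagBasis F y)
    (hp : p ∈ invariantRing (Gluing.rep (flagBimodule G₁ G₂)))
    (hP : HasLead d (toPolyFst y p) P) {α : Fin n →₀ ℕ} (hα : α ∈ P.support) (j : Fin n) :
    Fintype.card K ^ flagExp F j ∣ α j := by
  let _ := Fintype.ofFinite (flagDual F (flagIndex F j))
  rw [← card_flagDual_pow]
  obtain ⟨i, hi, hij, hji⟩ := exists_flagIndex_eq hF₀ hF₁ y j
  have hdeg : α.degree = d := by
    by_contra hne
    exact (MvPolynomial.mem_support_iff.1 hα) (hP.1.coeff_eq_zero hne)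
  refine card_dvd_of_translation_invariant
    (linForm ∘ₗ (flagDual F (flagIndex F j)).subtype).toAddMonoidHom
    (linForm_injective.comp Subtype.val_injective) j d (toPolyFst y p) hP.totalDegree_le
    (fun u => ?_) α hdeg (by rw [hP.2 α hdeg.ge]; exact MvPolynomial.mem_support_iff.1 hα)
  -- The vector `w` dual to `y j` lies in `F_i'` for all `i' > i`, and `u` vanishes on `F_i`, so
  -- `x ↦ u x • w` preserves the flag.
  set w : W := (evalEquiv K W).symm (y.coord j) with hw
  have hyw : ∀ k, y k w = if k = j then 1 else 0 := fun k => by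
    rw [hw, apply_evalEquiv_symm_apply, Basis.coord_apply, Basis.repr_self,
      Finsupp.single_apply]
  have hmem : (u : Dual K W).smulRight w ∈ (flagBimodule G₁ G₂).toAddSubgroup := by
    intro i'
    rw [Submodule.map_le_iff_le_comap]
    intro x hx
    rw [Submodule.mem_comap, LinearMap.smulRight_apply]
    rcases le_or_gt i' i.castSucc with hle | hlt
    · rw [mem_flagDual.1 u.2 x (F.monotone (hi ▸ hle) hx), zero_smul]
      exact zero_mem _
    · refine Submodule.smul_mem _ _ ?_
      rw [← Subspace.forall_mem_dualAnnihilator_apply_eq_zero_iff]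
      intro θ hθ
      rw [← Submodule.range_dualMap_mkQ_eq, ← hy i'] at hθ
      induction hθ using Submodule.span_induction with
      | mem θ hθ =>
        obtain ⟨k, hk, rfl⟩ := hθ
        rw [hyw, if_neg]
        rintro rfl
        have h₁ : flagDim F i.succ ≤ flagDim F i' :=
          Submodule.finrank_mono (F.monotone (Fin.castSucc_lt_iff_succ_le.1 hlt))
        have h₂ : flagDim F i' ≤ k := hk
        omega
      | zero => rfl
      | add θ η _ _ hθ hη => rw [LinearMap.add_apply, hθ, hη, add_zero]
      | smul c θ _ hθ => rw [LinearMap.smul_apply, hθ, smul_zero]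
  have hcomp : ∀ k, y k ∘ₗ (u : Dual K W).smulRight w = if k = j then (u : Dual K W) else 0 :=
    fun k => by
      ext x
      rw [LinearMap.comp_apply, LinearMap.smulRight_apply, map_smul, hyw]
      split_ifs <;> simp
  have h := toPolyFst_rep_hom y (⟨1, (u : Dual K W).smulRight w, 1, hmem⟩ : ParabolicGluing G₁ G₂)
    rfl rfl j (fun k hk => by rw [hcomp, if_neg hk]) p
  rw [hp, hcomp, if_pos rfl] at h
  exact h.symm

end LeadingFormsOfInvariants

/-! ### Leading forms of the `f̃_j` -/

section LeadingFormsOfTilde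

open MvPolynomial

variable {K W : Type*} [Field K] [Fintype K] [AddCommGroup W] [Module K W]
  [FiniteDimensional K W] {F : LTSeries (Submodule K W)} {n : ℕ} {y : Basis (Fin n) K (Dual K W)}

lemma hasLead_flagNorm (j : ℕ) (k : Fin n) :
    HasLead (Fintype.card K ^ flagExp F j) (toPolyFst y (flagNorm F (flagIndex F j) (y k)))
      (X k ^ Fintype.card K ^ flagExp F j) := by
  let _ := Fintype.ofFinite (flagDual F (flagIndex F j))
  rw [flagNorm_eq_prod, map_prod, ← card_flagDual_pow]
  simp only [map_add, toPolyFst_basis, toPolyFst_snd]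
  simpa using HasLead.prod Finset.univ fun (u : flagDual F (flagIndex F j)) _ =>
    HasLead.X_add_C (R := CoordRing K W) k (linForm (u : Dual K W))

lemma toPolyFst_flagTilde (f : Fin n → CoordRing K W) (j : Fin n) :
    toPolyFst y (flagTilde F y f j) =
      aeval (fun k => toPolyFst y (flagNorm F (flagIndex F j) (y k)))
        (SymmetricAlgebra.equivMvPolynomial y (f j)) := by
  have h : (toPolyFst y).comp (SymmetricAlgebra.lift (flagNormLinear F (flagIndex F j))) =
      (aeval fun k => toPolyFst y (flagNorm F (flagIndex F j) (y k))).comp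
        (SymmetricAlgebra.equivMvPolynomial y).toAlgHom := by
    refine SymmetricAlgebra.algHom_ext (y.ext fun k => ?_)
    change toPolyFst y (SymmetricAlgebra.lift _ (SymmetricAlgebra.ι K _ (y k))) =
      aeval _ (SymmetricAlgebra.equivMvPolynomial y (SymmetricAlgebra.ι K _ (y k)))
    rw [SymmetricAlgebra.lift_ι_apply, SymmetricAlgebra.equivMvPolynomial_ι_apply, aeval_X,
      flagNormLinear_apply]
  rw [flagTilde_eq]
  exact DFunLike.congr_fun h (f j)

lemma hasLead_flagTilde {f : Fin n → CoordRing K W} (j : Fin n) (hf : IsHomogeneousForm (f j)) :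
    ∃ d, HasLead d (toPolyFst y (flagTilde F y f j)) (map (algebraMap K (CoordRing K W))
      (SymmetricAlgebra.equivMvPolynomial y (f j) ^ Fintype.card K ^ flagExp F j)) := by
  obtain ⟨d, hd⟩ := hf.isHomogeneous y
  have h := hd.hasLead_aeval (hasLead_flagNorm (F := F) (y := y) j)
  have hmap : (aeval fun k =>
      (X k : MvPolynomial (Fin n) (CoordRing K W)) ^ Fintype.card K ^ flagExp F j) =
      (mapAlgHom (Algebra.ofId K (CoordRing K W))).comp
        (aeval fun k => (X k : MvPolynomial (Fin n) K) ^ Fintype.card K ^ flagExp F j) :=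
    MvPolynomial.algHom_ext fun k => by simp
  rw [hmap, AlgHom.comp_apply, aeval_X_pow_card, ← toPolyFst_flagTilde] at h
  exact ⟨_, h⟩

end LeadingFormsOfTilde

section Lifting

open MvPolynomial

variable {K A R σ ι : Type*} [Field K] [CommRing A] [Algebra K A] [CommRing R] [Nontrivial R]
  [Algebra K R]

/-- The homogeneous components of a polynomial in the leading forms of the `φ j` are leading forms
of polynomials in the `φ j`. -/
lemma exists_hasLead_of_mem_adjoin (E : A →ₐ[K] MvPolynomial σ R) {φ : ι → A}
    {t : ι → MvPolynomial σ K}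
    (ht : ∀ j, ∃ d, HasLead d (E (φ j)) (map (algebraMap K R) (t j))) {p : MvPolynomial σ K}
    (hp : p ∈ Algebra.adjoin K (Set.range t)) (d : ℕ) :
    ∃ g ∈ Algebra.adjoin K (Set.range φ),
      HasLead d (E g) (map (algebraMap K R) (homogeneousComponent d p)) := by
  rw [← Subalgebra.mem_toSubmodule, Algebra.adjoin_eq_span] at hp
  induction hp using Submodule.span_induction with
  | mem m hm =>
    obtain ⟨d', g, hg, hlead⟩ : ∃ d', ∃ g ∈ Algebra.adjoin K (Set.range φ),
        HasLead d' (E g) (map (algebraMap K R) m) := by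
      induction hm using Submonoid.closure_induction with
      | mem x hx =>
        obtain ⟨j, rfl⟩ := hx
        obtain ⟨d', h⟩ := ht j
        exact ⟨d', φ j, Algebra.subset_adjoin ⟨j, rfl⟩, h⟩
      | one =>
        refine ⟨0, 1, one_mem _, ?_⟩
        rw [map_one, map_one]
        exact HasLead.of_isHomogeneous (isHomogeneous_one _ _)
      | mul x x' _ _ hx hx' =>
        obtain ⟨d₁, g₁, hg₁, h₁⟩ := hx
        obtain ⟨d₂, g₂, hg₂, h₂⟩ := hx'
        refine ⟨d₁ + d₂, g₁ * g₂, mul_mem hg₁ hg₂, ?_⟩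
        rw [map_mul, map_mul]
        exact h₁.mul h₂
    have hm : m.IsHomogeneous d' := hlead.1.of_map (FaithfulSMul.algebraMap_injective K R)
    rw [homogeneousComponent_of_mem hm]
    split_ifs with h
    · subst h
      exact ⟨g, hg, hlead⟩
    · exact ⟨0, zero_mem _, by simpa using HasLead.zero d⟩
  | zero => exact ⟨0, zero_mem _, by simpa using HasLead.zero d⟩
  | add x x' _ _ hx hx' =>
    obtain ⟨g, hg, h⟩ := hx
    obtain ⟨g', hg', h'⟩ := hx'
    exact ⟨g + g', add_mem hg hg', by simpa only [map_add] using h.add h'⟩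
  | smul c x _ hx =>
    obtain ⟨g, hg, h⟩ := hx
    refine ⟨c • g, Subalgebra.smul_mem _ hg c, ?_⟩
    have h' := h.C_mul (algebraMap K R c)
    rw [← MvPolynomial.algebraMap_eq, ← IsScalarTower.algebraMap_apply, ← Algebra.smul_def,
      ← map_smul, IsScalarTower.algebraMap_apply K R, MvPolynomial.algebraMap_eq, ← map_C,
      ← map_mul, ← smul_eq_C_mul, ← map_smul] at h'
    exact h'

end Lifting

/-! ### The ring of invariants of the gluing -/

section Invariants

open MvPolynomial

variable {K W : Type*} [Field K] [AddCommGroup W] [Module K W] [FiniteDimensional K W]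
  {F : LTSeries (Submodule K W)} {G₁ G₂ : Subgroup (parabolicSubgroup F)} {n : ℕ}

omit [FiniteDimensional K W] in
lemma inclSnd_mem_invariantRing {r : CoordRing K W} (hr : r ∈ invariantRing (naturalRep G₂)) :
    inclSnd r ∈ invariantRing (Gluing.rep (flagBimodule G₁ G₂)) := by
  intro a
  conv_rhs => rw [← hr a.snd]
  rw [inclSnd, coordPullback_coordPullback, coordPullback_coordPullback]
  rfl

variable [Fintype K] {y : Basis (Fin n) K (Dual K W)} {f : Fin n → CoordRing K W}

/-- The leading form of an invariant of the gluing is a combination, with coefficients in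
`K[W₂]^G₂`, of polynomials in the leading forms `f_j ^ (q ^ e_j)` of the `f̃_j`. -/
lemma exists_mem_adjoin_hasLead (hF₀ : F.head = ⊥) (hF₁ : F.last = ⊤) (hy : IsFlagBasis F y)
    (hf : IsFlagConsistent F y f)
    (hfG : invariantRing (naturalRep G₁) = Algebra.adjoin K (Set.range f))
    {p : CoordRing K (W × W)} (hp : p ∈ invariantRing (Gluing.rep (flagBimodule G₁ G₂)))
    {d : ℕ} {P : MvPolynomial (Fin n) (CoordRing K W)} (hP : HasLead d (toPolyFst y p) P) :
    ∃ g ∈ Algebra.adjoin K (Set.range (flagTilde F y f) ∪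
        inclSnd '' (invariantRing (naturalRep G₂) : Set (CoordRing K W))),
      HasLead d (toPolyFst y g) P := by
  set e := SymmetricAlgebra.equivMvPolynomial y with he
  have hn : Fintype.card (Fin n) = finrank K W := by
    rw [← Subspace.dual_finrank_eq, finrank_eq_card_basis y]
  have hind : AlgebraicIndependent K fun j => e (f j) :=
    (algebraicIndependent_of_invariantRing_eq_adjoin (naturalRep G₁) f hn hfG).map'
      (f := e.toAlgHom) e.injective
  have hvars : ∀ j : Fin n, e (f j) ∈ Algebra.adjoin K
      (X '' {k : Fin n | flagExp F k ≤ flagExp F j}) := fun j => by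
    obtain ⟨i, hi, hij, hji⟩ := exists_flagIndex_eq hF₀ hF₁ y j
    have h : e (f j) ∈ (Algebra.adjoin K ((fun k => linForm (y k)) ''
        {k | flagDim F i.castSucc ≤ (k : ℕ)})).map e.toAlgHom := ⟨f j, hf.2 i j hij hji, rfl⟩
    rw [AlgHom.map_adjoin] at h
    refine Algebra.adjoin_mono ?_ h
    rintro _ ⟨_, ⟨k, hk, rfl⟩, rfl⟩
    refine ⟨k, flagExp_le (hi ▸ hk), ?_⟩
    exact ((equivMvPolynomial_linForm y (y k)).trans (coordLinear_basis y k)).symm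
  have hT : ∀ l : CoordRing K W →ₗ[K] K, coeffFunctional l P ∈ Subalgebra.toSubmodule
      (Algebra.adjoin K (Set.range fun j => e (f j) ^ Fintype.card K ^ flagExp F j)) := by
    intro l
    have hmem : coeffFunctional l P ∈ Algebra.adjoin K (Set.range fun j => e (f j)) := by
      have h := coeffFunctional_mem_invariantRing_of_hasLead hp hP l
      rw [hfG] at h
      have h' : coeffFunctional l P ∈ (Algebra.adjoin K (Set.range f)).map e.toAlgHom :=
        ⟨_, h, e.apply_symm_apply _⟩
      rw [AlgHom.map_adjoin, ← Set.range_comp] at h'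
      exact h'
    obtain ⟨x, hx⟩ := mem_range_aeval_X_pow (F := coeffFunctional l P)
      (m := fun k : Fin n => Fintype.card K ^ flagExp F k) fun α hα k => by
        refine card_dvd_of_hasLead hF₀ hF₁ hy hp hP (MvPolynomial.mem_support_iff.2 fun h0 => ?_) k
        rw [MvPolynomial.mem_support_iff, coeff_coeffFunctional, h0, map_zero] at hα
        exact hα rfl
    rw [← hx] at hmem ⊢
    exact mem_adjoin_pow_of_mem_adjoin (e := fun k : Fin n => flagExp F k) hvars
      (det_jacobian_ne_zero_of_invariantRing_eq_adjoin (naturalRep G₁) y f hfG) hind hmem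
  obtain ⟨π, hπ, hPπ⟩ := exists_projection_of_coeffFunctional_mem _ P hT
  choose g hg hlead using fun α => exists_hasLead_of_mem_adjoin (toPolyFst y)
    (φ := flagTilde F y f) (fun j => hasLead_flagTilde j (hf.1 j)) (hπ α) d
  refine ⟨∑ α ∈ P.support, inclSnd (coeff α P) * g α, sum_mem fun α _ => mul_mem ?_ ?_, ?_⟩
  · exact Algebra.subset_adjoin
      (Or.inr ⟨_, coeff_mem_invariantRing_of_hasLead hp hP α, rfl⟩)
  · exact Algebra.adjoin_mono Set.subset_union_left (hg α)
  · have hcomp : P = ∑ α ∈ P.support, C (coeff α P) *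
        map (algebraMap K (CoordRing K W)) (homogeneousComponent d (π α)) := by
      conv_lhs => rw [← homogeneousComponent_eq_self hP.1]
      conv_lhs => rw [hPπ]
      rw [map_sum]
      refine Finset.sum_congr rfl fun α _ => ?_
      rw [homogeneousComponent_C_mul]
      congr 1
      ext β
      simp only [coeff_homogeneousComponent, coeff_map]
      split_ifs <;> simp
    have hsum : HasLead d (∑ α ∈ P.support, toPolyFst y (inclSnd (coeff α P) * g α))
        (∑ α ∈ P.support, C (coeff α P) *
          map (algebraMap K (CoordRing K W)) (homogeneousComponent d (π α))) :=
      HasLead.sum _ fun α _ => by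
        rw [map_mul, toPolyFst_inclSnd]
        exact (hlead α).C_mul _
    rwa [← hcomp, ← map_sum] at hsum


end Invariants

end

theorem theorem7p2 {K W : Type*} [Field K] [Finite K] [AddCommGroup W] [Module K W]
    [FiniteDimensional K W]
    (F : LTSeries (Submodule K W)) (hF₀ : F.head = ⊥) (hF₁ : F.last = ⊤)
    (G₁ G₂ : Subgroup (parabolicSubgroup F))
    {n : ℕ} (y : Module.Basis (Fin n) K (Module.Dual K W)) (hy : IsFlagBasis F y)
    (f h : Fin n → CoordRing K W)
    (hf : IsFlagConsistent F y f)
    (hfG : invariantRing (naturalRep G₁) = Algebra.adjoin K (Set.range f))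
    (hh : ∀ j, IsHomogeneousForm (h j))
    (hhG : invariantRing (naturalRep G₂) = Algebra.adjoin K (Set.range h)) :
    invariantRing (Gluing.rep (flagBimodule G₁ G₂)) =
        Algebra.adjoin K (Set.range (flagTilde F y f) ∪ Set.range fun j => inclSnd (h j)) ∧
      AlgebraicIndependent K (Sum.elim (flagTilde F y f) fun j => inclSnd (h j)) := by
  have := Fintype.ofFinite K
  have hadj : Algebra.adjoin K
      (Set.range (flagTilde F y f) ∪ Set.range fun j => inclSnd (h j)) ≤
        invariantRing (Gluing.rep (flagBimodule G₁ G₂)) := by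
    refine Algebra.adjoin_le ?_
    rintro _ (⟨j, rfl⟩ | ⟨j, rfl⟩)
    · exact flagTilde_mem_invariantRing hF₀ hF₁ hy hf j
        (hfG ▸ Algebra.subset_adjoin ⟨j, rfl⟩)
    · exact inclSnd_mem_invariantRing (hhG ▸ Algebra.subset_adjoin ⟨j, rfl⟩)
  have hgen : invariantRing (Gluing.rep (flagBimodule G₁ G₂)) =
      Algebra.adjoin K (Set.range (flagTilde F y f) ∪ Set.range fun j => inclSnd (h j)) := by
    refine le_antisymm ?_ hadj
    -- Induction on a bound `d` for the degree in the coordinates of `W₁`, stated as the vanishing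
    -- of the leading form in degree `d`.
    · suffices hind : ∀ d : ℕ, ∀ p ∈ invariantRing (Gluing.rep (flagBimodule G₁ G₂)),
          HasLead d (toPolyFst y p) 0 → p ∈ Algebra.adjoin K
            (Set.range (flagTilde F y f) ∪ Set.range fun j => inclSnd (h j)) from
        fun p hp => hind _ p hp (HasLead.of_totalDegree_lt (Nat.lt_succ_self _))
      have hle : Algebra.adjoin K (Set.range (flagTilde F y f) ∪
          inclSnd '' (invariantRing (naturalRep G₂) : Set (CoordRing K W))) ≤
          Algebra.adjoin K (Set.range (flagTilde F y f) ∪ Set.range fun j => inclSnd (h j)) := by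
        refine Algebra.adjoin_le ?_
        rintro _ (⟨j, rfl⟩ | ⟨r, hr, rfl⟩)
        · exact Algebra.subset_adjoin (Or.inl ⟨j, rfl⟩)
        · have hr' : inclSnd r ∈ (Algebra.adjoin K (Set.range h)).map inclSnd :=
            ⟨r, hhG ▸ hr, rfl⟩
          rw [AlgHom.map_adjoin, ← Set.range_comp] at hr'
          exact Algebra.adjoin_mono Set.subset_union_right hr'
      intro d
      induction d with
      | zero =>
        intro p _ hlead
        have h0 : toPolyFst y p = 0 := by
          ext1 α
          rw [hlead.2 α (Nat.zero_le _)]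
        rw [(injective_iff_map_eq_zero _).1 (toPolyFst_injective y) p h0]
        exact zero_mem _
      | succ d ih =>
        intro p hp hlead
        obtain ⟨g, hg, hglead⟩ :=
          exists_mem_adjoin_hasLead hF₀ hF₁ hy hf hfG hp hlead.homogeneousComponent_of_zero
        have hgS := hle hg
        have hgG : g ∈ invariantRing (Gluing.rep (flagBimodule G₁ G₂)) := hadj hgS
        have hdiff := hlead.homogeneousComponent_of_zero.sub hglead
        rw [sub_self, ← map_sub] at hdiff
        simpa using add_mem (ih (p - g) (sub_mem hp hgG) hdiff) hgS
  refine ⟨hgen, algebraicIndependent_of_invariantRing_eq_adjoin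
    (Gluing.rep (flagBimodule G₁ G₂)) _ ?_ ?_⟩
  · rw [Fintype.card_sum, Fintype.card_fin, finrank_prod, ← Subspace.dual_finrank_eq,
      finrank_eq_card_basis y, Fintype.card_fin]
  · rw [hgen, Set.Sum.elim_range]
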